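/- Let $K$ be an algebraically closed field of any characteristic, let $n$ be a natural number, and identify $\mathbb G_m^n$ with the group $(K\setminus\{0\})^n$ equipped with the Zariski topology, whose closed sets are the algebraic subsets, i.e. the common zero sets of finitely many Laurent polynomials in $K[X_1^{\pm1},\dots,X_n^{\pm1}]$. Dimension means Krull dimension. A torsion coset is a set $\boldsymbol\zeta G$, where $\boldsymbol\zeta\in\mathbb G_m^n$ has finite order and $G<\mathbb G_m^n$ is an irreducible algebraic subgroup. An algebraic subset $X\subset\mathbb G_m^n$ is called admissible if it is finite or does not contain a torsion coset of dimension $\dim X$. The stabilizer $\mathrm{Stab}(X)$ is the set of $\mathbf g\in\mathbb G_m^n$ with $\mathbf gX\subset X$. For real $T\ge1$ let $X_T$ be the set of points of $X$ that have finite order at most $T$ in the group $\mathbb G_m^n$. Let $X\subset\mathbb G_m^n$ be an irreducible and admissible algebraic subset of dimension $d$, and let $\delta=\dim\mathrm{Stab}(X)$. Then $\delta\le d$, and there is a constant $C$, depending only on $X$ (and on $K$ and $n$), such that for all real $T\ge1$ the set $X_T$ is finite and $$\#X_T\le C\,T^{\,d+1-\frac1{d-\delta+1}}.$$ In particular the exponent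 is strictly smaller than $d+1$. -/

import Mathlib

namespace AlgTorus

/-- The group of `K`-points of the `n`-dimensional algebraic torus, `(K ∖ {0})ⁿ`. -/
abbrev Torus (K : Type*) [Field K] (n : ℕ) : Type _ := Fin n → Kˣ

/-- The ring of Laurent polynomials `K[X₁^{±1}, …, Xₙ^{±1}]`, as the group algebra of `ℤⁿ`. -/
abbrev Laurent (K : Type*) [Field K] (n : ℕ) : Type _ := AddMonoidAlgebra K (Fin n → ℤ)

/-- The monomial character `a ↦ x₁^{a₁} ⋯ xₙ^{aₙ}` of `ℤⁿ` attached to a point `x`. -/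
def monomialAt {K : Type*} [Field K] {n : ℕ} (x : Torus K n) :
    Multiplicative (Fin n → ℤ) →* K where
  toFun a := ((∏ i, x i ^ (a.toAdd i) : Kˣ) : K)
  map_one' := by simp
  map_mul' a b := by
    simp [zpow_add, Finset.prod_mul_distrib]

/-- Evaluation of Laurent polynomials at a point of the torus. -/
noncomputable def evalAt {K : Type*} [Field K] {n : ℕ} (x : Torus K n) : Laurent K n →ₐ[K] K :=
  AddMonoidAlgebra.lift K K (Fin n → ℤ) (monomialAt x)

/-- The common zeros in the torus of a set of Laurent polynomials. -/
def zeroLocus {K : Type*} [Field K] {n : ℕ} (S : Set (Laurent K n)) : Set (Torus K n) :=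
  {x | ∀ P ∈ S, evalAt x P = 0}

/-- Algebraic subsets: common zeros of finitely many Laurent polynomials. -/
def IsAlgebraicSet {K : Type*} [Field K] {n : ℕ} (X : Set (Torus K n)) : Prop :=
  ∃ S : Finset (Laurent K n), X = zeroLocus (S : Set (Laurent K n))

/-- The Zariski topology on the torus: the closed sets are the zero loci of sets of Laurent
polynomials. -/
instance zariskiTopology (K : Type*) [Field K] (n : ℕ) : TopologicalSpace (Torus K n) :=
  TopologicalSpace.ofClosed {X | ∃ S : Set (Laurent K n), X = zeroLocus S}
    ⟨{1}, by ext x; simp [zeroLocus]⟩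
    (by
      intro A hA
      refine ⟨{P | ∃ S : Set (Laurent K n), zeroLocus S ∈ A ∧ P ∈ S}, ?_⟩
      ext x
      simp only [Set.mem_sInter, zeroLocus, Set.mem_ofPred_eq]
      constructor
      · rintro h P ⟨S, hS, hP⟩
        exact h _ hS P hP
      · intro h X hX
        obtain ⟨S, rfl⟩ := hA hX
        exact fun P hP => h P ⟨S, hX, hP⟩)
    (by
      rintro _ ⟨S, rfl⟩ _ ⟨S', rfl⟩
      refine ⟨{R | ∃ P ∈ S, ∃ Q ∈ S', R = P * Q}, ?_⟩
      ext x
      simp only [Set.mem_union, zeroLocus, Set.mem_ofPred_eq]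
      constructor
      · rintro (h | h) _ ⟨P, hP, Q, hQ, rfl⟩
        · rw [map_mul, h P hP, zero_mul]
        · rw [map_mul, h Q hQ, mul_zero]
      · intro h
        by_contra! hc
        obtain ⟨⟨P, hP, hP0⟩, Q, hQ, hQ0⟩ := hc
        have := h (P * Q) ⟨P, hP, Q, hQ, rfl⟩
        rw [map_mul] at this
        exact (mul_ne_zero hP0 hQ0) this)

/-- The dimension of a subset of the torus: the Krull dimension of the subspace, i.e. the supremum
of the lengths of chains of its irreducible closed subsets (`⊥` for the empty set). -/
noncomputable def dim {K : Type*} [Field K] {n : ℕ} (X : Set (Torus K n)) : WithBot ℕ∞ :=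
  topologicalKrullDim X

/-- Linear tori: the irreducible algebraic subgroups. -/
def IsLinearTorus {K : Type*} [Field K] {n : ℕ} (G : Subgroup (Torus K n)) : Prop :=
  IsAlgebraicSet (G : Set (Torus K n)) ∧ IsIrreducible (G : Set (Torus K n))

/-- Torsion cosets `ζG`, with `ζ` a torsion point and `G` a linear torus. -/
def IsTorsionCoset {K : Type*} [Field K] {n : ℕ} (C : Set (Torus K n)) : Prop :=
  ∃ (ζ : Torus K n) (G : Subgroup (Torus K n)),
    IsOfFinOrder ζ ∧ IsLinearTorus G ∧ C = (fun g => ζ * g) '' (G : Set (Torus K n))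

/-- `X` is admissible if it is finite or contains no torsion coset of dimension `dim X`. -/
def IsAdmissible {K : Type*} [Field K] {n : ℕ} (X : Set (Torus K n)) : Prop :=
  X.Finite ∨ ∀ C : Set (Torus K n), IsTorsionCoset C → dim C = dim X → ¬ C ⊆ X

/-- The stabilizer `{g | gX ⊆ X}`. -/
def stab {K : Type*} [Field K] {n : ℕ} (X : Set (Torus K n)) : Set (Torus K n) :=
  {g | ∀ x ∈ X, g * x ∈ X}

/-- The set `X_T` of torsion points of `X` of order at most `T`. -/
def torsionUpTo {K : Type*} [Field K] {n : ℕ} (X : Set (Torus K n)) (T : ℝ) : Set (Torus K n) :=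
  {ζ | ζ ∈ X ∧ IsOfFinOrder ζ ∧ (orderOf ζ : ℝ) ≤ T}

end AlgTorus

/-! Dimension is handled through the transcendence degree `tr X` of the coordinate ring. Only `tr X
≤ dim X` is needed, because for fixed `δ` the exponent increases with the dimension. Projecting to
`tr X` algebraically independent coordinates has bounded fibres off a proper closed subset, which
gives the trivial bound `T ^ (tr X + 1)` (`torsionBound_of_tr`).

To save a power, let `relLattice X` be the lattice of monomials constant on `X`. Always `tr X + rank
≤ n`, and equality is the case of cosets of tori. If the inequality is strict, some `m = tr X + 1`
coordinates of `X` satisfy no multiplicative relation modulo constants, so `X` is replaced by a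
hypersurface `Y` in the torus of dimension `m`, on which some `P ≠ 0` vanishes. By Dirichlet
approximation a torsion point of order `N` has the form `η * cochar a τ` with `η ^ g = 1` and `g *
|a i|` of size at most `N ^ (1 - 1/m)` up to a constant. On a coset of the one-parameter subgroup of
direction `a` where `P` is not identically zero, it has `O(max |a i|)` zeros. Summing over `g`, `η`
and `a` yields `T ^ (m - 1/m)` (`torsionBound_isolated`).

The points lying on a one-parameter coset inside `P = 0` involve only finitely many directions `a`.
For each of them they form a closed subset of `Y`. If it is proper, the trivial bound suffices. If
it is all of `Y`, then `Y` is stable under the one-parameter subgroup, and the quotient has smaller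
dimension and is still not a coset. A bound with exponent `e > 1` on the quotient lifts to exponent
`e + 1` (`TorsionBound.of_quot`), so induction on the dimension applies
(`torsionBound_of_not_coset`).

The same lifting, applied `δ` times along the stabilizer, replaces `1/(d+1)` by `1/(d-δ+1)`
(`torsionBound_of_stabilizer`). The required one-parameter subgroups exist because a closed
submonoid is cut out by characters (`mem_of_forall_chr_eq_one`). In the coset case, a single torsion
point on `X` would make `X` a torsion coset (`isTorsionCoset_of_le`), against admissibility. -/

namespace AlgTorus

open TopologicalSpace

/-! ### Characters, monomial maps and the Zariski topology -/

section Basic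

variable {K : Type*} [Field K] {n k : ℕ}

/-- The character `x ↦ x^m` of the torus. -/
def chr (x : Torus K n) (m : Fin n → ℤ) : Kˣ := ∏ i, x i ^ m i

theorem chr_add (x : Torus K n) (m m' : Fin n → ℤ) : chr x (m + m') = chr x m * chr x m' := by
  simp [chr, zpow_add, Finset.prod_mul_distrib]

@[simp] theorem chr_zero (x : Torus K n) : chr x 0 = 1 := by simp [chr]

theorem chr_mul (x y : Torus K n) (m : Fin n → ℤ) : chr (x * y) m = chr x m * chr y m := by
  simp [chr, mul_zpow, Finset.prod_mul_distrib]

@[simp] theorem chr_one (m : Fin n → ℤ) : chr (1 : Torus K n) m = 1 := by simp [chr]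

theorem chr_neg (x : Torus K n) (m : Fin n → ℤ) : chr x (-m) = (chr x m)⁻¹ := by
  simp [chr]

theorem chr_sub (x : Torus K n) (m m' : Fin n → ℤ) : chr x (m - m') = chr x m / chr x m' := by
  rw [sub_eq_add_neg, chr_add, chr_neg, div_eq_mul_inv]

theorem chr_smul (x : Torus K n) (c : ℤ) (m : Fin n → ℤ) : chr x (c • m) = chr x m ^ c := by
  simp only [chr, Pi.smul_apply, smul_eq_mul, ← Finset.prod_zpow]
  refine Finset.prod_congr rfl fun i _ => ?_
  rw [mul_comm, zpow_mul]

theorem chr_sum {ι : Type*} (x : Torus K n) (s : Finset ι) (f : ι → Fin n → ℤ) :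
    chr x (∑ i ∈ s, f i) = ∏ i ∈ s, chr x (f i) := by
  classical
  induction s using Finset.induction_on with
  | empty => simp
  | insert i s hi ih => rw [Finset.sum_insert hi, Finset.prod_insert hi, chr_add, ih]

@[simp] theorem chr_single (x : Torus K n) (i : Fin n) (c : ℤ) :
    chr x (Pi.single i c) = x i ^ c := by
  rw [chr, Finset.prod_eq_single i]
  · simp
  · intro j _ hj; simp [hj]
  · simp

theorem evalAt_single (x : Torus K n) (m : Fin n → ℤ) (c : K) :
    evalAt x (AddMonoidAlgebra.single m c) = c * (chr x m : K) := by
  simp [evalAt, AddMonoidAlgebra.lift_single, monomialAt, chr]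

theorem evalAt_eq_sum (x : Torus K n) (P : Laurent K n) :
    evalAt x P = ∑ m ∈ P.coeff.support, P.coeff m * (chr x m : K) := by
  simp [evalAt, AddMonoidAlgebra.lift_apply, Finsupp.sum, monomialAt, chr]

/-- The monomial homomorphism of tori attached to an integer matrix. -/
def monoMap (B : Fin k → Fin n → ℤ) : Torus K n →* Torus K k where
  toFun x j := chr x (B j)
  map_one' := by ext; simp
  map_mul' x y := by ext; simp [chr_mul]

theorem monoMap_apply (B : Fin k → Fin n → ℤ) (x : Torus K n) (j : Fin k) :
    monoMap B x j = chr x (B j) := rfl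

theorem chr_monoMap (B : Fin k → Fin n → ℤ) (x : Torus K n) (m : Fin k → ℤ) :
    chr (monoMap B x) m = chr x (∑ j, m j • B j) := by
  rw [chr_sum]
  exact Finset.prod_congr rfl fun j _ => (chr_smul x (m j) (B j)).symm

/-- Pullback of Laurent polynomials along `x ↦ g * monoMap B x`. -/
noncomputable def pull (g : Torus K k) (B : Fin k → Fin n → ℤ) : Laurent K k →ₐ[K] Laurent K n :=
  AddMonoidAlgebra.lift K (Laurent K n) (Fin k → ℤ)
    { toFun := fun m => AddMonoidAlgebra.single (∑ j, m.toAdd j • B j) (chr g m.toAdd : K)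
      map_one' := by simp [AddMonoidAlgebra.one_def]
      map_mul' := fun a b => by
        simp [AddMonoidAlgebra.single_mul_single, chr_add, add_smul, Finset.sum_add_distrib] }

theorem evalAt_pull (g : Torus K k) (B : Fin k → Fin n → ℤ) (x : Torus K n) (P : Laurent K k) :
    evalAt x (pull g B P) = evalAt (g * monoMap B x) P := by
  have : (evalAt x).comp (pull g B) = evalAt (g * monoMap B x) := by
    apply AddMonoidAlgebra.algHom_ext
    · intro m
      simp [pull, evalAt_single, chr_mul, chr_monoMap]
    · ext
  exact DFunLike.congr_fun this P

theorem isClosed_iff {X : Set (Torus K n)} :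
    IsClosed X ↔ ∃ S : Set (Laurent K n), X = zeroLocus S := by
  rw [← isOpen_compl_iff]
  change Xᶜᶜ ∈ _ ↔ _
  rw [compl_compl]; rfl

theorem isClosed_zeroLocus (S : Set (Laurent K n)) : IsClosed (zeroLocus S) :=
  isClosed_iff.2 ⟨S, rfl⟩

theorem isClosed_setOf_evalAt (P : Laurent K n) : IsClosed {x : Torus K n | evalAt x P = 0} := by
  convert isClosed_zeroLocus {P}
  ext x; simp [zeroLocus]

theorem IsAlgebraicSet.isClosed {X : Set (Torus K n)} (h : IsAlgebraicSet X) : IsClosed X := by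
  obtain ⟨S, rfl⟩ := h
  exact isClosed_zeroLocus _

theorem continuous_mul_monoMap (g : Torus K k) (B : Fin k → Fin n → ℤ) :
    Continuous fun x : Torus K n => g * monoMap B x := by
  refine continuous_iff_isClosed.2 fun C hC => ?_
  obtain ⟨S, rfl⟩ := isClosed_iff.1 hC
  refine isClosed_iff.2 ⟨pull g B '' S, ?_⟩
  ext x
  simp [zeroLocus, evalAt_pull]

theorem continuous_monoMap (B : Fin k → Fin n → ℤ) :
    Continuous (monoMap B : Torus K n → Torus K k) := by
  simpa using continuous_mul_monoMap (1 : Torus K k) B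

theorem monoMap_single (x : Torus K n) : monoMap (fun i => Pi.single i 1) x = x := by
  ext i; simp [monoMap_apply]

theorem continuous_mul_left_torus (g : Torus K n) : Continuous fun x : Torus K n => g * x := by
  simpa only [monoMap_single] using continuous_mul_monoMap g (fun i => Pi.single i 1)

theorem continuous_mul_right_torus (g : Torus K n) : Continuous fun x : Torus K n => x * g := by
  simpa only [mul_comm] using continuous_mul_left_torus g

/-- Left translation as a homeomorphism of the torus. -/
def translate (g : Torus K n) : Torus K n ≃ₜ Torus K n where
  toEquiv := Equiv.mulLeft g
  continuous_toFun := continuous_mul_left_torus g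
  continuous_invFun := continuous_mul_left_torus g⁻¹

/-- The ideal of Laurent polynomials vanishing on `X`. -/
def vanIdeal (X : Set (Torus K n)) : Ideal (Laurent K n) where
  carrier := {P | ∀ x ∈ X, evalAt x P = 0}
  zero_mem' := by simp
  add_mem' := fun ha hb x hx => by simp [ha x hx, hb x hx]
  smul_mem' := fun c P hP x hx => by simp [hP x hx]

theorem mem_vanIdeal {X : Set (Torus K n)} {P : Laurent K n} :
    P ∈ vanIdeal X ↔ ∀ x ∈ X, evalAt x P = 0 := Iff.rfl

theorem vanIdeal_anti {X Y : Set (Torus K n)} (h : X ⊆ Y) : vanIdeal Y ≤ vanIdeal X :=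
  fun _ hP x hx => hP x (h hx)

theorem zeroLocus_vanIdeal {X : Set (Torus K n)} (hX : IsClosed X) :
    zeroLocus (vanIdeal X : Set (Laurent K n)) = X := by
  obtain ⟨S, rfl⟩ := isClosed_iff.1 hX
  refine Set.Subset.antisymm (fun x hx P hP => hx P fun y hy => hy P hP) fun x hx P hP => hP x hx

theorem vanIdeal_closure (X : Set (Torus K n)) : vanIdeal (closure X) = vanIdeal X := by
  refine le_antisymm (vanIdeal_anti subset_closure) fun P hP x hx => ?_
  exact closure_minimal (t := {x | evalAt x P = 0}) (fun y hy => hP y hy)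
    (isClosed_setOf_evalAt P) hx

theorem vanIdeal_isPrime {X : Set (Torus K n)} (hX : IsIrreducible X) : (vanIdeal X).IsPrime := by
  refine ⟨?_, fun {P Q} hPQ => ?_⟩
  · obtain ⟨x, hx⟩ := hX.1
    intro h
    have : (1 : Laurent K n) ∈ vanIdeal X := h ▸ trivial
    simpa using this x hx
  · have := isPreirreducible_iff_isClosed_union_isClosed.1 hX.2 _ _ (isClosed_setOf_evalAt P)
      (isClosed_setOf_evalAt Q) (fun x hx => by simpa using hPQ x hx)
    exact this.imp (fun h x hx => h hx) fun h x hx => h hx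

theorem isIrreducible_of_isPrime {X : Set (Torus K n)} (hX : (vanIdeal X).IsPrime) :
    IsIrreducible X := by
  refine ⟨?_, isPreirreducible_iff_isClosed_union_isClosed.2 fun Z W hZ hW hZW => ?_⟩
  · by_contra h
    rw [Set.not_nonempty_iff_eq_empty] at h
    exact hX.ne_top (by ext; simp [h, mem_vanIdeal])
  · by_contra! hc
    obtain ⟨⟨z, hz, hz'⟩, w, hw, hw'⟩ := hc.imp Set.not_subset.1 Set.not_subset.1
    rw [← zeroLocus_vanIdeal hZ] at hz'
    rw [← zeroLocus_vanIdeal hW] at hw'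
    simp only [zeroLocus, Set.mem_ofPred_eq, not_forall] at hz' hw'
    obtain ⟨P, hP, hPz⟩ := hz'
    obtain ⟨Q, hQ, hQw⟩ := hw'
    have : P * Q ∈ vanIdeal X := fun x hx => by
      rcases hZW hx with h | h
      · simp [hP x h]
      · simp [hQ x h]
    rcases hX.mem_or_mem this with h | h
    · exact hPz (h z hz)
    · exact hQw (h w hw)

instance : Algebra.FiniteType K (Laurent K n) := inferInstance

instance : IsNoetherianRing (Laurent K n) := Algebra.FiniteType.isNoetherianRing K _

instance : IsDomain (Laurent K n) := inferInstance

instance : NoetherianSpace (Torus K n) := by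
  refine ((noetherianSpace_TFAE (Torus K n)).out 0 1 :
    _ ↔ WellFoundedLT (Closeds (Torus K n))).2 ?_
  have := (inferInstance : WellFoundedGT (Ideal (Laurent K n)))
  refine StrictAnti.wellFoundedLT (f := fun X : Closeds (Torus K n) => vanIdeal (X : Set (Torus K n))) ?_
  intro X Y hXY
  refine lt_of_le_of_ne (vanIdeal_anti hXY.le) fun h => hXY.ne ?_
  ext1
  rw [← zeroLocus_vanIdeal X.isClosed, ← zeroLocus_vanIdeal Y.isClosed]
  exact congrArg (fun I : Ideal (Laurent K n) => zeroLocus (I : Set (Laurent K n))) h.symm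

/-- Hilbert's basis theorem: finitely many generators of the vanishing ideal suffice. -/
theorem isAlgebraicSet_of_isClosed {X : Set (Torus K n)} (hX : IsClosed X) : IsAlgebraicSet X := by
  obtain ⟨S, hS⟩ := IsNoetherian.noetherian (vanIdeal X)
  refine ⟨S, ?_⟩
  conv_lhs => rw [← zeroLocus_vanIdeal hX, ← hS]
  refine Set.Subset.antisymm (fun x hx P hP => hx P (Ideal.subset_span hP)) fun x hx P hP => ?_
  have : Ideal.span (S : Set (Laurent K n)) ≤ RingHom.ker (evalAt x) :=
    Ideal.span_le.2 fun Q hQ => hx Q hQ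
  exact this hP

theorem evalAt_single_one (x : Torus K n) (m : Fin n → ℤ) :
    evalAt x (AddMonoidAlgebra.single m 1) = (chr x m : K) := by
  rw [evalAt_single, one_mul]

/-- The coordinate ring of `X`. -/
abbrev Coord (X : Set (Torus K n)) : Type _ := Laurent K n ⧸ vanIdeal X

/-- The transcendence degree of the coordinate ring. -/
noncomputable def tr (X : Set (Torus K n)) : ℕ := (Algebra.trdeg K (Coord X)).toNat

theorem tr_closure (X : Set (Torus K n)) : tr (closure X) = tr X := by
  unfold tr Coord; rw [vanIdeal_closure]

/-- Finite type makes the transcendence degree finite, so `toNat` in `tr` never takes its default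
value. -/
theorem coe_tr (X : Set (Torus K n)) : (tr X : Cardinal) = Algebra.trdeg K (Coord X) :=
  Cardinal.cast_toNat_of_lt_aleph0 trdeg_lt_aleph0_of_finiteType

end Basic

/-! ### Transcendence degree, Nullstellensatz and Krull dimension -/

section DimensionTheory

/-- A surjection of finitely generated domains over a field which does not lower the transcendence
degree is injective. -/
theorem injective_of_trdeg_le {K : Type*} {A B : Type*} [Field K] [CommRing A] [IsDomain A]
    [CommRing B] [IsDomain B] [Algebra K A] [Algebra K B] [Algebra.FiniteType K A]
    [Algebra.FiniteType K B] (φ : A →ₐ[K] B) (hφ : Function.Surjective φ)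
    (h : (Algebra.trdeg K A).toNat ≤ (Algebra.trdeg K B).toNat) : Function.Injective φ := by
  obtain ⟨t, ht⟩ := exists_isTranscendenceBasis K B
  have hB : Algebra.trdeg K B < Cardinal.aleph0 := trdeg_lt_aleph0_of_finiteType
  have hA : Algebra.trdeg K A < Cardinal.aleph0 := trdeg_lt_aleph0_of_finiteType
  have hcard := ht.cardinalMk_eq_trdeg
  have hfin : Finite t := Cardinal.lt_aleph0_iff_finite.1 (hcard ▸ hB)
  choose x hx using fun y : t => hφ y
  have hind : AlgebraicIndependent K x := by
    refine AlgebraicIndependent.of_comp φ ?_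
    convert ht.1 using 1
    ext y; exact hx y
  have hbas : IsTranscendenceBasis K x := by
    refine hind.isTranscendenceBasis_of_lift_trdeg_le_of_finite ?_
    have h1 : Nat.card t = (Algebra.trdeg K B).toNat := by rw [← hcard]; rfl
    rw [← Cardinal.cast_toNat_of_lt_aleph0 hA, ← Nat.cast_card, Cardinal.lift_natCast,
      Cardinal.lift_natCast, h1]
    exact_mod_cast h
  have halg := hbas.isAlgebraic
  rw [injective_iff_map_eq_zero]
  intro f hf
  by_contra hf0
  -- By algebraicity, a nonzero kernel element divides a nonzero polynomial expression `r` in the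
  -- lifts `x`. Then `φ r = 0` is a relation among the independent elements of `t`.
  obtain ⟨r, hr, c, hc⟩ := (halg.isAlgebraic f).exists_nonzero_dvd
    (mem_nonZeroDivisors_of_ne_zero hf0)
  have hr0 : φ (r : A) = 0 := by
    have : (r : A) = f * c := hc
    rw [this, map_mul, hf, zero_mul]
  obtain ⟨p, hp⟩ : ∃ p : MvPolynomial t K, MvPolynomial.aeval x p = (r : A) := by
    have h1 : ∀ a ∈ Algebra.adjoin K (Set.range x), ∃ p : MvPolynomial t K, MvPolynomial.aeval x p = a := by
      intro a ha
      rwa [Algebra.adjoin_range_eq_range_aeval] at ha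
    exact h1 _ r.2
  have : MvPolynomial.aeval (fun y : t => (y : B)) p = 0 := by
    rw [← hr0, ← hp, MvPolynomial.aeval_def, MvPolynomial.aeval_def, ← AlgHom.coe_toRingHom φ,
      MvPolynomial.hom_eval₂]
    congr 1
    · ext; simp
    · ext y; exact (hx y).symm
  have hp0 : p = 0 := (map_eq_zero_iff _ ht.1).1 this
  apply hr
  ext
  simp [← hp, hp0]

/-- Noether normalization makes `A` integral over a polynomial ring in `s` variables, with `s` the
transcendence degree. A chain of primes of length `s` there lifts to `A` by going up. -/
theorem trdeg_le_ringKrullDim (K A : Type*) [Field K] [CommRing A] [IsDomain A] [Algebra K A]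
    [Algebra.FiniteType K A] :
    ((Algebra.trdeg K A).toNat : WithBot ℕ∞) ≤ ringKrullDim A := by
  obtain ⟨s, g, hg, hint⟩ := exists_integral_inj_algHom_of_fg K A
  algebraize [g.toRingHom]
  have hinj : Function.Injective (algebraMap (MvPolynomial (Fin s) K) A) := hg
  have : FaithfulSMul (MvPolynomial (Fin s) K) A := (faithfulSMul_iff_algebraMap_injective _ _).2 hg
  have : Algebra.IsIntegral (MvPolynomial (Fin s) K) A := ⟨hint⟩
  have htr : (Algebra.trdeg K A).toNat = s := by
    have halg : Algebra.IsAlgebraic (MvPolynomial (Fin s) K) A := inferInstance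
    have := lift_trdeg_add_eq K (MvPolynomial (Fin s) K) A
    rw [trdeg_eq_zero (R := MvPolynomial (Fin s) K) (A := A)] at this
    have h2 := congrArg Cardinal.toNat this
    simpa using h2.symm
  rw [htr]
  have hs : (s : WithBot ℕ∞) ≤ Order.krullDim (PrimeSpectrum (MvPolynomial (Fin s) K)) := by
    have := MvPolynomial.ringKrullDim_of_isNoetherianRing (R := K) (ι := Fin s)
    rw [ringKrullDim] at this
    rw [this]
    simp
  obtain ⟨l, hl⟩ := Order.le_krullDim_iff.1 hs
  obtain ⟨P, hP, hP', hlo⟩ := Ideal.exists_ideal_over_prime_of_isIntegral l.head.asIdeal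
    (⊥ : Ideal A) (by
      intro x hx
      have : x = 0 := by simpa using hx
      simp [this])
  have : P.LiesOver l.head.asIdeal := ⟨hlo.symm⟩
  obtain ⟨L, hL, -⟩ := Ideal.exists_ltSeries_of_hasGoingUp l P
  rw [← hl, ← hL]
  exact Order.LTSeries.length_le_krullDim L

variable {K : Type*} [Field K] {n k : ℕ}

/-- Monomials are units, so `ψ` restricts to a homomorphism from `ℤⁿ` to `Kˣ`, and the images of the
basis vectors are the coordinates of the point. -/
theorem exists_evalAt_eq (ψ : Laurent K n →ₐ[K] K) : ∃ x : Torus K n, ψ = evalAt x := by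
  let χ : Multiplicative (Fin n → ℤ) →* Kˣ :=
    MonoidHom.toHomUnits ((AddMonoidAlgebra.lift K K (Fin n → ℤ)).symm ψ)
  have hχ : ∀ m, (χ (Multiplicative.ofAdd m) : K) = ψ (AddMonoidAlgebra.single m 1) :=
    fun m => rfl
  refine ⟨fun i => χ (Multiplicative.ofAdd (Pi.single i 1)), ?_⟩
  apply AddMonoidAlgebra.algHom_ext
  · intro m
    rw [evalAt_single_one, ← hχ, Units.val_inj, chr]
    conv_lhs => rw [← Finset.univ_sum_single m, ofAdd_sum, map_prod]
    refine Finset.prod_congr rfl fun i _ => ?_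
    rw [← map_zpow, ← ofAdd_zsmul, ← Pi.single_smul]
    simp
  · ext

/-- The Nullstellensatz: in a Jacobson ring a prime is an intersection of maximal ideals, and each
of these is the kernel of evaluation at a point because its residue field is finite over `K`. -/
theorem vanIdeal_zeroLocus [IsAlgClosed K] (P : Ideal (Laurent K n)) [P.IsPrime] :
    vanIdeal (zeroLocus (P : Set (Laurent K n))) = P := by
  refine le_antisymm (fun f hf => ?_) fun f hf x hx => hx f hf
  have hJ : IsJacobsonRing (Laurent K n) := isJacobsonRing_of_finiteType (A := K)
  by_contra hfP
  have hjac : P.jacobson = P := IsJacobsonRing.out inferInstance (Ideal.IsPrime.isRadical ‹_›)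
  rw [← hjac, Ideal.jacobson, Ideal.mem_sInf] at hfP
  push Not at hfP
  obtain ⟨M, ⟨hPM, hM⟩, hfM⟩ := hfP
  let _ : Field (Laurent K n ⧸ M) := Ideal.Quotient.field M
  have := finite_of_finite_type_of_isJacobsonRing K (Laurent K n ⧸ M)
  let e : K ≃ₐ[K] (Laurent K n ⧸ M) := AlgEquiv.ofBijective (Algebra.ofId K _)
    (IsAlgClosed.algebraMap_bijective_of_isIntegral)
  obtain ⟨x, hx⟩ := exists_evalAt_eq ((e.symm : _ →ₐ[K] K).comp (Ideal.Quotient.mkₐ K M))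
  have key : ∀ g, evalAt x g = 0 ↔ g ∈ M := by
    intro g
    rw [← hx]
    simp [Ideal.Quotient.eq_zero_iff_mem]
  exact hfM ((key f).1 (hf x fun g hg => (key g).2 (hPM hg)))

theorem isIrreducible_preimage_val {α : Type*} [TopologicalSpace α] {X Z : Set α} (hZX : Z ⊆ X)
    (hZ : IsIrreducible Z) : IsIrreducible ((↑) ⁻¹' Z : Set X) := by
  refine ⟨?_, isPreirreducible_iff_isClosed_union_isClosed.2 fun A B hA hB hAB => ?_⟩
  · obtain ⟨z, hz⟩ := hZ.1
    exact ⟨⟨z, hZX hz⟩, hz⟩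
  · obtain ⟨A', hA', rfl⟩ := isClosed_induced_iff.1 hA
    obtain ⟨B', hB', rfl⟩ := isClosed_induced_iff.1 hB
    refine (isPreirreducible_iff_isClosed_union_isClosed.1 hZ.2 A' B' hA' hB' ?_).imp
      (fun h x hx => h hx) (fun h x hx => h hx)
    exact fun z hz => hAB (a := ⟨z, hZX hz⟩) hz

/-- An irreducible closed subset `Z` of `X`, as an irreducible closed set of the subspace. -/
def irreducibleClosedsOfSubset {α : Type*} [TopologicalSpace α] {X Z : Set α} (hZX : Z ⊆ X)
    (hZ : IsIrreducible Z) (hZc : IsClosed Z) : IrreducibleCloseds X where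
  carrier := (↑) ⁻¹' Z
  isIrreducible' := isIrreducible_preimage_val hZX hZ
  isClosed' := hZc.preimage continuous_subtype_val

theorem image_irreducibleClosedsOfSubset {α : Type*} [TopologicalSpace α] {X Z : Set α}
    (hZX : Z ⊆ X) (hZ : IsIrreducible Z) (hZc : IsClosed Z) :
    Subtype.val '' (irreducibleClosedsOfSubset hZX hZ hZc : Set X) = Z := by
  change Subtype.val '' (Subtype.val ⁻¹' Z) = Z
  rw [Subtype.image_preimage_coe, Set.inter_eq_self_of_subset_right hZX]

/-- Zero loci turn chains of primes of the coordinate ring into chains of irreducible closed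
subsets, in reverse order; by the Nullstellensatz strictness is kept. -/
theorem tr_le_dim [IsAlgClosed K] {X : Set (Torus K n)} (hX : IsClosed X) (hirr : IsIrreducible X) :
    (tr X : WithBot ℕ∞) ≤ dim X := by
  have := vanIdeal_isPrime hirr
  refine (trdeg_le_ringKrullDim K (Coord X)).trans ?_
  rw [ringKrullDim, ← Order.krullDim_orderDual, dim, topologicalKrullDim]
  let Q : PrimeSpectrum (Coord X) → Ideal (Laurent K n) := fun p =>
    p.asIdeal.comap (Ideal.Quotient.mk (vanIdeal X))
  have hQp : ∀ p, (Q p).IsPrime := fun p => Ideal.comap_isPrime _ _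
  have hQ : ∀ p, vanIdeal X ≤ Q p := fun p f hf => by
    simp [Q, Ideal.Quotient.eq_zero_iff_mem.2 hf]
  have hsub : ∀ p, zeroLocus (Q p : Set (Laurent K n)) ⊆ X := fun p x hx => by
    rw [← zeroLocus_vanIdeal hX]
    exact fun f hf => hx f (hQ p hf)
  have hirr' : ∀ p, IsIrreducible (zeroLocus (Q p : Set (Laurent K n))) := fun p =>
    isIrreducible_of_isPrime (by rw [vanIdeal_zeroLocus]; exact hQp p)
  let F : (PrimeSpectrum (Coord X))ᵒᵈ → IrreducibleCloseds X := fun p =>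
    irreducibleClosedsOfSubset (hsub (OrderDual.ofDual p)) (hirr' _) (isClosed_zeroLocus _)
  have hF : ∀ p, Subtype.val '' (F p : Set X) =
      zeroLocus (Q (OrderDual.ofDual p) : Set (Laurent K n)) := fun p =>
    image_irreducibleClosedsOfSubset _ _ _
  refine Order.krullDim_le_of_strictMono F (Monotone.strictMono_of_injective ?_ ?_)
  · intro p q hpq x hx f hf
    exact hx f (Ideal.comap_mono (OrderDual.ofDual_le_ofDual.2 hpq) hf)
  · intro p q h
    have h2 : vanIdeal (Subtype.val '' (F p : Set X)) = vanIdeal (Subtype.val '' (F q : Set X)) := by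
      rw [h]
    rw [hF, hF, vanIdeal_zeroLocus, vanIdeal_zeroLocus] at h2
    refine OrderDual.ofDual.injective (PrimeSpectrum.ext ?_)
    exact Ideal.comap_injective_of_surjective _ Ideal.Quotient.mk_surjective h2

/-- The surjection of coordinate rings does not lower the transcendence degree, so it is injective
and the vanishing ideals agree. -/
theorem eq_of_subset_of_tr_le {X Y : Set (Torus K n)} (hX : IsClosed X) (hXi : IsIrreducible X)
    (hY : IsClosed Y) (hYi : IsIrreducible Y) (hYX : Y ⊆ X) (h : tr X ≤ tr Y) : Y = X := by
  have := vanIdeal_isPrime hXi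
  have := vanIdeal_isPrime hYi
  have hle := vanIdeal_anti hYX
  have hinj := injective_of_trdeg_le (Ideal.Quotient.factorₐ K hle)
    (Ideal.Quotient.factor_surjective hle) h
  have : vanIdeal Y = vanIdeal X := by
    refine le_antisymm (fun f hf => ?_) (vanIdeal_anti hYX)
    rw [← Ideal.Quotient.eq_zero_iff_mem] at hf ⊢
    exact (map_eq_zero_iff _ hinj).1 hf
  rw [← zeroLocus_vanIdeal hX, ← zeroLocus_vanIdeal hY, this]

theorem tr_lt_of_ssubset {X Y : Set (Torus K n)} (hX : IsClosed X) (hXi : IsIrreducible X)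
    (hY : IsClosed Y) (hYi : IsIrreducible Y) (hYX : Y ⊂ X) : tr Y < tr X := by
  by_contra! h
  exact hYX.ne (eq_of_subset_of_tr_le hX hXi hY hYi hYX.subset h)

end DimensionTheory

/-! ### Counting torsion points: formal properties -/

section Counting

variable {K : Type*} [Field K] {n k : ℕ}

theorem finite_pow_eq_one (k : ℕ) {N : ℕ} (hN : 0 < N) :
    {x : Torus K k | x ^ N = 1}.Finite ∧ {x : Torus K k | x ^ N = 1}.ncard ≤ N ^ k := by
  classical
  have : NeZero N := ⟨hN.ne'⟩
  have := Fintype.ofFinite (rootsOfUnity N K)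
  let R : Finset Kˣ := (Finset.univ : Finset (rootsOfUnity N K)).map (Function.Embedding.subtype _)
  have hR : ∀ u : Kˣ, u ∈ R ↔ u ^ N = 1 := by
    intro u; simp [R, mem_rootsOfUnity]
  have hcard : R.card ≤ N := by
    rw [Finset.card_map, Finset.card_univ, ← Nat.card_eq_fintype_card]
    exact card_rootsOfUnity K N
  have heq : {x : Torus K k | x ^ N = 1} = (Fintype.piFinset fun _ : Fin k => R : Set _) := by
    ext x
    simp [hR, funext_iff]
  rw [heq]
  refine ⟨Finset.finite_toSet _, ?_⟩
  rw [Set.ncard_coe_finset, Fintype.card_piFinset_const]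
  simpa using Nat.pow_le_pow_left hcard _

theorem torsionUpTo_subset_biUnion (X : Set (Torus K n)) (T : ℝ) :
    torsionUpTo X T ⊆ ⋃ N ∈ Finset.Icc 1 ⌊T⌋₊, {x : Torus K n | x ^ N = 1} := by
  intro x hx
  simp only [Set.mem_iUnion]
  refine ⟨orderOf x, Finset.mem_Icc.2 ⟨hx.2.1.orderOf_pos, Nat.le_floor hx.2.2⟩,
    pow_orderOf_eq_one x⟩

theorem finite_torsionUpTo (X : Set (Torus K n)) (T : ℝ) : (torsionUpTo X T).Finite := by
  refine Set.Finite.subset ?_ (torsionUpTo_subset_biUnion X T)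
  exact Set.Finite.biUnion (Finset.finite_toSet _) fun N hN =>
    (finite_pow_eq_one n (Finset.mem_Icc.1 hN).1).1

theorem torsionUpTo_mono {X Y : Set (Torus K n)} (h : X ⊆ Y) (T : ℝ) :
    torsionUpTo X T ⊆ torsionUpTo Y T := fun _ hx => ⟨h hx.1, hx.2⟩

/-- The number of torsion points of order at most `T` on `X` is `O(T ^ e)`. -/
def TorsionBound (X : Set (Torus K n)) (e : ℝ) : Prop :=
  ∃ C : ℝ, ∀ T : ℝ, 1 ≤ T → ((torsionUpTo X T).ncard : ℝ) ≤ C * T ^ e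

theorem TorsionBound.exists_nonneg {X : Set (Torus K n)} {e : ℝ} (h : TorsionBound X e) :
    ∃ C : ℝ, 0 ≤ C ∧ ∀ T : ℝ, 1 ≤ T → ((torsionUpTo X T).ncard : ℝ) ≤ C * T ^ e := by
  obtain ⟨C, hC⟩ := h
  refine ⟨C, ?_, hC⟩
  have := hC 1 le_rfl
  simp only [Real.one_rpow, mul_one] at this
  exact le_trans (Nat.cast_nonneg _) this

theorem TorsionBound.mono {X Y : Set (Torus K n)} {e e' : ℝ} (h : TorsionBound Y e) (hXY : X ⊆ Y)
    (he : e ≤ e') : TorsionBound X e' := by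
  obtain ⟨C, hC0, hC⟩ := h.exists_nonneg
  refine ⟨C, fun T hT => ?_⟩
  calc ((torsionUpTo X T).ncard : ℝ) ≤ (torsionUpTo Y T).ncard := by
        exact_mod_cast Set.ncard_le_ncard (torsionUpTo_mono hXY T) (finite_torsionUpTo Y T)
    _ ≤ C * T ^ e := hC T hT
    _ ≤ C * T ^ e' := by gcongr

theorem TorsionBound.union {X Y : Set (Torus K n)} {e : ℝ} (hX : TorsionBound X e)
    (hY : TorsionBound Y e) : TorsionBound (X ∪ Y) e := by
  obtain ⟨C, hC⟩ := hX
  obtain ⟨D, hD⟩ := hY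
  refine ⟨C + D, fun T hT => ?_⟩
  have : torsionUpTo (X ∪ Y) T = torsionUpTo X T ∪ torsionUpTo Y T := by
    ext x; simp only [torsionUpTo, Set.mem_ofPred_eq, Set.mem_union]; tauto
  rw [this, add_mul]
  refine le_trans ?_ (add_le_add (hC T hT) (hD T hT))
  exact_mod_cast Set.ncard_union_le _ _

theorem torsionBound_empty (e : ℝ) : TorsionBound (∅ : Set (Torus K n)) e :=
  ⟨0, fun T _ => by simp [torsionUpTo]⟩

theorem TorsionBound.biUnion {ι : Type*} {S : Set ι} (hS : S.Finite) {X : ι → Set (Torus K n)}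
    {e : ℝ} (h : ∀ i ∈ S, TorsionBound (X i) e) : TorsionBound (⋃ i ∈ S, X i) e := by
  induction S, hS using Set.Finite.induction_on with
  | empty => simpa using torsionBound_empty e
  | @insert a s _ _ ih =>
    rw [Set.biUnion_insert]
    exact (h a (Set.mem_insert _ _)).union (ih fun i hi => h i (Set.mem_insert_of_mem _ hi))

/-- Counting along a map with fibres of bounded size. -/
theorem ncard_le_mul_ncard_of_fiber {α β : Type*} {A : Set α} {B : Set β} (f : α → β)
    (hB : B.Finite) (hf : Set.MapsTo f A B) (hA : A.Finite) {C : ℕ}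
    (h : ∀ b ∈ B, {a ∈ A | f a = b}.ncard ≤ C) : A.ncard ≤ C * B.ncard := by
  classical
  lift A to Finset α using hA
  lift B to Finset β using hB
  rw [Set.ncard_coe_finset, Set.ncard_coe_finset]
  refine Finset.card_le_mul_card_image_of_maps_to (fun a ha => hf ha) C fun b hb => ?_
  refine le_trans (le_of_eq ?_) (h b hb)
  rw [← Set.ncard_coe_finset]
  congr 1
  ext a; simp

/-- A homomorphism sends torsion points to torsion points without raising the order. -/
theorem TorsionBound.of_fiber {X : Set (Torus K n)} {Y : Set (Torus K k)} {e : ℝ}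
    (f : Torus K n →* Torus K k) (hf : Set.MapsTo f X Y) {C : ℕ}
    (h : ∀ y, {x ∈ X | f x = y}.Finite ∧ {x ∈ X | f x = y}.ncard ≤ C)
    (hY : TorsionBound Y e) : TorsionBound X e := by
  obtain ⟨D, hD⟩ := hY
  refine ⟨C * D, fun T hT => ?_⟩
  have key : (torsionUpTo X T).ncard ≤ C * (torsionUpTo Y T).ncard := by
    refine ncard_le_mul_ncard_of_fiber f (finite_torsionUpTo Y T) ?_ (finite_torsionUpTo X T) ?_
    · intro x hx
      refine ⟨hf hx.1, f.isOfFinOrder hx.2.1, le_trans ?_ hx.2.2⟩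
      exact_mod_cast Nat.le_of_dvd hx.2.1.orderOf_pos (orderOf_map_dvd f x)
    · intro y _
      exact (Set.ncard_le_ncard (t := {x ∈ X | f x = y}) (fun x hx => ⟨hx.1.1, hx.2⟩) (h y).1).trans (h y).2
  calc ((torsionUpTo X T).ncard : ℝ) ≤ C * (torsionUpTo Y T).ncard := by exact_mod_cast key
    _ ≤ C * (D * T ^ e) := by gcongr; exact hD T hT
    _ = C * D * T ^ e := by ring

/-- There are at most `N ^ k` points with `x ^ N = 1`; sum over `N ≤ T`. -/
theorem torsionBound_univ (k : ℕ) : TorsionBound (Set.univ : Set (Torus K k)) (k + 1) := by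
  refine ⟨1, fun T hT => ?_⟩
  have hT0 : (0 : ℝ) ≤ T := by linarith
  have h1 : (torsionUpTo (Set.univ : Set (Torus K k)) T).ncard ≤ ⌊T⌋₊ * ⌊T⌋₊ ^ k := by
    have hfin : ∀ N ∈ Finset.Icc 1 ⌊T⌋₊, {x : Torus K k | x ^ N = 1}.Finite := fun N hN =>
      (finite_pow_eq_one k (Finset.mem_Icc.1 hN).1).1
    refine (Set.ncard_le_ncard (torsionUpTo_subset_biUnion _ T)
      (Set.Finite.biUnion (Finset.finite_toSet _) hfin)).trans ?_
    refine (Finset.set_ncard_biUnion_le _ _).trans ?_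
    refine (Finset.sum_le_card_nsmul _ _ (⌊T⌋₊ ^ k) fun N hN => ?_).trans (by simp)
    rw [Finset.mem_Icc] at hN
    exact (finite_pow_eq_one k hN.1).2.trans (Nat.pow_le_pow_left hN.2 k)
  have h2 : ((torsionUpTo (Set.univ : Set (Torus K k)) T).ncard : ℝ) ≤ T * T ^ k := by
    refine le_trans (Nat.cast_le.2 h1) ?_
    push_cast
    have := Nat.floor_le hT0
    gcongr
  rw [one_mul, Real.rpow_add (by linarith), Real.rpow_one, Real.rpow_natCast, mul_comm]
  exact h2

end Counting

/-! ### Coordinates as transcendence bases and bounded fibres -/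

section Coordinates

variable {K : Type*} [Field K] {n k : ℕ}

/-- The class of the monomial `x^m` in the coordinate ring. -/
noncomputable def mon (X : Set (Torus K n)) (m : Fin n → ℤ) : Coord X :=
  Ideal.Quotient.mk (vanIdeal X) (AddMonoidAlgebra.single m 1)

theorem mon_add (X : Set (Torus K n)) (m m' : Fin n → ℤ) :
    mon X (m + m') = mon X m * mon X m' := by
  simp [mon, ← map_mul, AddMonoidAlgebra.single_mul_single]

theorem mon_zero (X : Set (Torus K n)) : mon X 0 = 1 := by
  simp [mon, ← AddMonoidAlgebra.one_def]

theorem mon_nsmul (X : Set (Torus K n)) (m : Fin n → ℤ) (c : ℕ) :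
    mon X (c • m) = mon X m ^ c := by
  induction c with
  | zero => simp [mon_zero]
  | succ c ih => rw [succ_nsmul, mon_add, ih, pow_succ]

theorem isUnit_mon (X : Set (Torus K n)) (m : Fin n → ℤ) : IsUnit (mon X m) :=
  IsUnit.of_mul_eq_one (mon X (-m)) (by rw [← mon_add, add_neg_cancel, mon_zero])

/-- The lift of a polynomial in monomials to a Laurent polynomial. -/
noncomputable def substMon {ι : Type*} (f : ι → Fin n → ℤ) : MvPolynomial ι K →ₐ[K] Laurent K n :=
  MvPolynomial.aeval fun j => AddMonoidAlgebra.single (f j) 1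

theorem evalAt_substMon {ι : Type*} (f : ι → Fin n → ℤ) (x : Torus K n) (p : MvPolynomial ι K) :
    evalAt x (substMon f p) = MvPolynomial.eval (fun j => (chr x (f j) : K)) p := by
  have : (evalAt x).comp (substMon f) = MvPolynomial.aeval fun j => (chr x (f j) : K) := by
    ext j; simp [substMon, evalAt_single]
  have h2 := DFunLike.congr_fun this p
  simpa [MvPolynomial.aeval_eq_eval] using h2

theorem mk_substMon {ι : Type*} (X : Set (Torus K n)) (f : ι → Fin n → ℤ) (p : MvPolynomial ι K) :
    Ideal.Quotient.mk (vanIdeal X) (substMon f p) = MvPolynomial.aeval (fun j => mon X (f j)) p := by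
  have : (Ideal.Quotient.mkₐ K (vanIdeal X)).comp (substMon f) =
      MvPolynomial.aeval fun j => mon X (f j) := by
    ext j; simp [substMon, mon]
  exact DFunLike.congr_fun this p

theorem aeval_mon_eq_zero_iff {ι : Type*} (X : Set (Torus K n)) (f : ι → Fin n → ℤ)
    (p : MvPolynomial ι K) : MvPolynomial.aeval (fun j => mon X (f j)) p = 0 ↔
      ∀ x ∈ X, MvPolynomial.eval (fun j => (chr x (f j) : K)) p = 0 := by
  rw [← mk_substMon, Ideal.Quotient.eq_zero_iff_mem, mem_vanIdeal]
  simp_rw [evalAt_substMon]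

theorem mon_mem_adjoin (X : Set (Torus K n)) (m : Fin n → ℤ) (hm : ∀ i, 0 ≤ m i) :
    mon X m ∈ Algebra.adjoin K (Set.range fun i => mon X (Pi.single i 1)) := by
  have hm' : m = ∑ i, (m i).toNat • Pi.single i (1 : ℤ) := by
    conv_lhs => rw [← Finset.univ_sum_single m]
    refine Finset.sum_congr rfl fun i _ => ?_
    rw [← Pi.single_smul]
    simp [hm i]
  have hprod : ∀ s : Finset (Fin n), mon X (∑ i ∈ s, (m i).toNat • Pi.single i (1 : ℤ)) ∈
      Algebra.adjoin K (Set.range fun i => mon X (Pi.single i 1)) := by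
    intro s
    induction s using Finset.induction_on with
    | empty => simp [mon_zero]
    | insert i s hi ih =>
      rw [Finset.sum_insert hi, mon_add, mon_nsmul]
      exact Subalgebra.mul_mem _ (Subalgebra.pow_mem _
        (Algebra.subset_adjoin (Set.mem_range_self i)) _) ih
  rw [hm']
  exact hprod _

/-- A Laurent monomial is a quotient `w / v` of ordinary monomials, hence a root of `v * X - w`.
This permits choosing a transcendence basis among the coordinates themselves. -/
theorem isAlgebraic_adjoin_coords {X : Set (Torus K n)} (hX : IsIrreducible X) :
    Algebra.IsAlgebraic (Algebra.adjoin K (Set.range fun i => mon X (Pi.single i 1))) (Coord X) := by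
  have := vanIdeal_isPrime hX
  set R := Algebra.adjoin K (Set.range fun i => mon X (Pi.single i 1)) with hR
  have hmon : ∀ m, IsAlgebraic R (mon X m) := by
    intro m
    let v : R := ⟨mon X fun i => (m i)⁻, mon_mem_adjoin X _ fun i => negPart_nonneg _⟩
    let w : R := ⟨mon X fun i => (m i)⁺, mon_mem_adjoin X _ fun i => posPart_nonneg _⟩
    refine ⟨Polynomial.C v * Polynomial.X - Polynomial.C w, fun h => ?_, ?_⟩
    · have h1 := congrArg (fun p => Polynomial.coeff p 1) h
      simp [Polynomial.coeff_C] at h1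
      exact (isUnit_mon X fun i => (m i)⁻).ne_zero (congrArg Subtype.val h1)
    · have hvw : mon X (fun i => (m i)⁻) * mon X m = mon X fun i => (m i)⁺ := by
        rw [← mon_add]
        congr 1
        ext i
        have := posPart_sub_negPart (m i)
        simp only [Pi.add_apply]
        linarith
      simpa [sub_eq_zero] using hvw
  refine ⟨fun f => ?_⟩
  obtain ⟨P, rfl⟩ := Ideal.Quotient.mk_surjective f
  induction P using AddMonoidAlgebra.induction_linear with
  | zero => simpa using isAlgebraic_zero
  | add p q hp hq => rw [map_add]; exact hp.add hq
  | single m c =>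
    have : (Ideal.Quotient.mk (vanIdeal X)) (AddMonoidAlgebra.single m c) =
        algebraMap R (Coord X) (algebraMap K R c) * mon X m := by
      rw [← IsScalarTower.algebraMap_apply, mon, ← Algebra.smul_def]
      change _ = Ideal.Quotient.mk (vanIdeal X) (c • AddMonoidAlgebra.single m 1)
      simp
    rw [this]
    exact (isAlgebraic_algebraMap _).mul (hmon m)

/-- A transcendence basis of the function field consisting of coordinates. -/
theorem exists_coords_isTranscendenceBasis {X : Set (Torus K n)} (hX : IsIrreducible X) :
    ∃ σ : Fin (tr X) → Fin n, Function.Injective σ ∧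
      IsTranscendenceBasis K fun j => mon X (Pi.single (σ j) 1) := by
  have := vanIdeal_isPrime hX
  have := isAlgebraic_adjoin_coords hX
  obtain ⟨t, ht, hbas⟩ := exists_isTranscendenceBasis_subset (R := K)
    (Set.range fun i => mon X (Pi.single i 1))
  have hcard : Cardinal.mk t = tr X := by rw [hbas.cardinalMk_eq_trdeg, coe_tr]
  obtain ⟨e⟩ : Nonempty (Fin (tr X) ≃ t) := by
    have : Cardinal.mk t = Cardinal.mk (ULift (Fin (tr X))) := by rw [hcard]; simp
    obtain ⟨e⟩ := Cardinal.eq.1 this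
    exact ⟨Equiv.ulift.symm.trans e.symm⟩
  choose σ hσ using fun y : t => ht y.2
  have hcomp : (fun j => mon X (Pi.single (σ (e j)) 1)) = Subtype.val ∘ e := by
    ext j; exact hσ _
  have hb : IsTranscendenceBasis K fun j => mon X (Pi.single (σ (e j)) 1) := by
    rw [hcomp]
    exact (isTranscendenceBasis_equiv e).2 hbas
  refine ⟨σ ∘ e, fun i j hij => ?_, hb⟩
  refine hb.1.injective (R := K) ?_
  change mon X (Pi.single ((σ ∘ e) i) 1) = mon X (Pi.single ((σ ∘ e) j) 1)
  rw [hij]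

/-- Every irreducible set maps, outside a proper closed subset, with bounded fibres to the torus
of dimension `tr X`. -/
theorem exists_bounded_fibers {X : Set (Torus K n)} {s : ℕ} {σ : Fin s → Fin n}
    (hX : IsIrreducible X) (hσ : IsTranscendenceBasis K fun j => mon X (Pi.single (σ j) 1)) :
    ∃ (h : MvPolynomial (Fin s) K) (C : ℕ), h ≠ 0 ∧ ∀ c : Torus K s,
      MvPolynomial.eval (fun j => (c j : K)) h ≠ 0 →
        {x ∈ X | x ∘ σ = c}.Finite ∧ {x ∈ X | x ∘ σ = c}.ncard ≤ C := by
  classical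
  have := vanIdeal_isPrime hX
  have halg := hσ.isAlgebraic
  have hq : ∀ i : Fin n, ∃ q : Polynomial (MvPolynomial (Fin s) K), q ≠ 0 ∧
      ∀ x ∈ X, (q.map (MvPolynomial.eval fun j => (x (σ j) : K))).eval (x i : K) = 0 := by
    intro i
    obtain ⟨q, hq0, hq⟩ := halg.isAlgebraic (mon X (Pi.single i 1))
    let e := hσ.1.aevalEquiv
    let er := e.symm.toAlgHom.toRingHom
    refine ⟨q.map er, ?_, fun x hx => ?_⟩
    · rwa [Ne, Polynomial.map_eq_zero_iff (f := er) e.symm.injective]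
    · let ex : Coord X →ₐ[K] K := Ideal.Quotient.liftₐ _ (evalAt x) fun a ha => ha x hx
      have hex : ∀ m, ex (mon X m) = (chr x m : K) := fun m =>
        evalAt_single_one x m
      have hring : (MvPolynomial.eval fun j => (x (σ j) : K)).comp er =
          (ex : Coord X →+* K).comp (algebraMap _ (Coord X)) := by
        ext r
        obtain ⟨p, rfl⟩ := e.surjective r
        have h1 : (e p : Coord X) = MvPolynomial.aeval (fun j => mon X (Pi.single (σ j) 1)) p :=
          hσ.1.aevalEquiv_apply_coe p
        change MvPolynomial.eval _ (e.symm (e p)) = ex (e p : Coord X)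
        rw [h1, e.symm_apply_apply, MvPolynomial.aeval_def, ← AlgHom.coe_toRingHom,
          MvPolynomial.hom_eval₂, MvPolynomial.eval, MvPolynomial.coe_eval₂Hom]
        congr 1
        · ext; simp
        · ext j; simp [hex]
      rw [Polynomial.map_map, hring, ← Polynomial.map_map]
      have h3 : (x i : K) = ex (mon X (Pi.single i 1)) := by simp [hex]
      rw [h3, Polynomial.eval_map]
      change Polynomial.eval₂ (ex : Coord X →+* K) ((ex : Coord X →+* K) _) _ = 0
      rw [Polynomial.eval₂_at_apply, Polynomial.eval_map]
      rw [Polynomial.aeval_def] at hq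
      rw [hq, map_zero]
  choose q hq0 hqX using hq
  -- Each coordinate is a root of `q i`, whose coefficients depend on the basis coordinates. Where
  -- no leading coefficient vanishes, coordinate `i` takes at most `natDegree (q i)` values.
  refine ⟨∏ i, (q i).leadingCoeff, ∏ i, (q i).natDegree, ?_, fun c hc => ?_⟩
  · exact Finset.prod_ne_zero_iff.2 fun i _ => Polynomial.leadingCoeff_ne_zero.2 (hq0 i)
  rw [map_prod, Finset.prod_ne_zero_iff] at hc
  let qc : Fin n → Polynomial K := fun i => (q i).map (MvPolynomial.eval fun j => (c j : K))
  have hqc : ∀ i, qc i ≠ 0 := fun i h => hc i (Finset.mem_univ i) (by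
    have := congrArg (fun p => p.coeff (q i).natDegree) h
    simpa [qc, Polynomial.coeff_map] using this)
  let F : Finset (Fin n → K) := Fintype.piFinset fun i => (qc i).roots.toFinset
  have hinj : Set.InjOn (fun x : Torus K n => fun i => (x i : K)) {x ∈ X | x ∘ σ = c} := by
    intro x _ y _ hxy
    ext i
    exact congrFun hxy i
  have hmaps : Set.MapsTo (fun x : Torus K n => fun i => (x i : K)) {x ∈ X | x ∘ σ = c} F := by
    rintro x ⟨hx, rfl⟩
    simp only [F, Finset.mem_coe, Fintype.mem_piFinset, Multiset.mem_toFinset]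
    exact fun i => (Polynomial.mem_roots (hqc i)).2 (hqX i x hx)
  refine ⟨Set.Finite.of_injOn hmaps hinj (Finset.finite_toSet _), ?_⟩
  refine (Set.ncard_le_ncard_of_injOn _ hmaps hinj (Finset.finite_toSet _)).trans ?_
  rw [Set.ncard_coe_finset, Fintype.card_piFinset]
  refine Finset.prod_le_prod' fun i _ => ?_
  exact (Multiset.toFinset_card_le _).trans ((Polynomial.card_roots' _).trans
    Polynomial.natDegree_map_le)

end Coordinates

/-! ### The trivial bound -/

section GeneralBound

variable {K : Type*} [Field K] {n k : ℕ}

/-- A nonzero polynomial in a transcendence basis of coordinates cuts out a proper closed subset. -/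
theorem exists_eval_ne_zero {ι : Type*} {X : Set (Torus K n)} {f : ι → Fin n → ℤ}
    (hf : AlgebraicIndependent K fun j => mon X (f j)) {p : MvPolynomial ι K} (hp : p ≠ 0) :
    ∃ x ∈ X, MvPolynomial.eval (fun j => (chr x (f j) : K)) p ≠ 0 := by
  by_contra! h
  rw [← aeval_mon_eq_zero_iff X f p] at h
  exact hp ((map_eq_zero_iff _ hf).1 h)

/-- Off the proper closed subset `h = 0`, the projection to `tr X` coordinates has bounded fibres.
The finitely many components of the exceptional set have smaller `tr`, and induction covers them. -/
theorem torsionBound_of_tr {X : Set (Torus K n)} (hX : IsClosed X) (hirr : IsIrreducible X) :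
    TorsionBound X (tr X + 1) := by
  induction hs : tr X using Nat.strong_induction_on generalizing X with
  | _ s ih =>
  subst hs
  obtain ⟨σ, -, hσ⟩ := exists_coords_isTranscendenceBasis hirr
  obtain ⟨h, C, hh0, hC⟩ := exists_bounded_fibers hirr hσ
  set Q : Laurent K n := substMon (fun j => Pi.single (σ j) 1) h
  have hQ : ∀ x : Torus K n, evalAt x Q = MvPolynomial.eval (fun j => ((x ∘ σ) j : K)) h := by
    intro x; simp [Q, evalAt_substMon]
  set Z := X ∩ {x | evalAt x Q = 0}
  have hZ : IsClosed Z := hX.inter (isClosed_setOf_evalAt Q)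
  have hZX : Z ⊂ X := by
    refine Set.inter_subset_left.ssubset_of_ne fun h => ?_
    obtain ⟨x, hx, hx'⟩ := exists_eval_ne_zero hσ.1 hh0
    have : x ∈ X ∩ {x | evalAt x Q = 0} := by rw [h]; exact hx
    exact hx' (by rw [← evalAt_substMon]; exact this.2)
  have h1 : TorsionBound Z (tr X + 1) := by
    obtain ⟨S, hSf, hSc, hSi, hZS⟩ := NoetherianSpace.exists_finite_set_isClosed_irreducible hZ
    rw [hZS, Set.sUnion_eq_biUnion]
    refine TorsionBound.biUnion hSf fun Y hY => ?_
    have hYX : Y ⊂ X := Set.ssubset_of_subset_of_ssubset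
      (hZS ▸ Set.subset_sUnion_of_mem hY) hZX
    have hlt := tr_lt_of_ssubset hX hirr (hSc Y hY) (hSi Y hY) hYX
    refine (ih _ hlt (hSc Y hY) (hSi Y hY) rfl).mono subset_rfl ?_
    have : (tr Y : ℝ) ≤ tr X := by exact_mod_cast hlt.le
    linarith
  have h2 : TorsionBound (X \ Z) (tr X + 1) := by
    refine TorsionBound.of_fiber (monoMap fun j => Pi.single (σ j) 1) (Set.mapsTo_univ _ _)
      (C := C) (fun c => ?_) (torsionBound_univ _)
    have hcomp : ∀ x : Torus K n, monoMap (fun j => Pi.single (σ j) 1) x = x ∘ σ := by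
      intro x; ext j; simp [monoMap_apply]
    simp only [hcomp]
    by_cases hc : MvPolynomial.eval (fun j => (c j : K)) h = 0
    · have : {x ∈ X \ Z | x ∘ σ = c} = ∅ := by
        ext x
        simp only [Set.mem_ofPred_eq, Set.mem_empty_iff_false, iff_false]
        rintro ⟨⟨hx, hxZ⟩, rfl⟩
        exact hxZ ⟨hx, (hQ x).trans hc⟩
      rw [this]; simp
    · have hsub : {x ∈ X \ Z | x ∘ σ = c} ⊆ {x ∈ X | x ∘ σ = c} := fun x hx => ⟨hx.1.1, hx.2⟩
      exact ⟨(hC c hc).1.subset hsub, (Set.ncard_le_ncard hsub (hC c hc).1).trans (hC c hc).2⟩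
  exact (h1.union h2).mono (fun x hx => by by_cases hxZ : x ∈ Z <;> simp [hx, hxZ]) le_rfl

theorem torsionBound_of_ssubset {X Z : Set (Torus K n)} (hX : IsClosed X) (hirr : IsIrreducible X)
    (hZ : IsClosed Z) (hZX : Z ⊂ X) : TorsionBound Z (tr X) := by
  obtain ⟨S, hSf, hSc, hSi, hZS⟩ := NoetherianSpace.exists_finite_set_isClosed_irreducible hZ
  rw [hZS, Set.sUnion_eq_biUnion]
  refine TorsionBound.biUnion hSf fun Y hY => ?_
  have hYX : Y ⊂ X := Set.ssubset_of_subset_of_ssubset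
    (hZS ▸ Set.subset_sUnion_of_mem hY) hZX
  have hlt := tr_lt_of_ssubset hX hirr (hSc Y hY) (hSi Y hY) hYX
  refine (torsionBound_of_tr (hSc Y hY) (hSi Y hY)).mono subset_rfl ?_
  exact_mod_cast hlt

end GeneralBound

/-! ### Laurent polynomials on one-parameter cosets -/

section OneParameter

variable {K : Type*} [Field K] {n : ℕ}

/-- The one-parameter subgroup `t ↦ t^a`. -/
def cochar (a : Fin n → ℤ) (t : Kˣ) : Torus K n := fun i => t ^ a i

theorem cochar_mul (a : Fin n → ℤ) (t u : Kˣ) : cochar a (t * u) = cochar a t * cochar a u := by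
  ext i; simp [cochar, mul_zpow]

theorem cochar_one (a : Fin n → ℤ) : cochar a (1 : Kˣ) = 1 := by
  ext i; simp [cochar]

theorem chr_cochar (a : Fin n → ℤ) (t : Kˣ) (m : Fin n → ℤ) : chr (cochar a t) m = t ^ (a ⬝ᵥ m) := by
  simp only [chr, cochar, dotProduct, ← zpow_mul]
  induction (Finset.univ : Finset (Fin n)) using Finset.induction_on with
  | empty => simp
  | insert i s hi ih => rw [Finset.prod_insert hi, Finset.sum_insert hi, zpow_add, ih]

theorem evalAt_mul_cochar (x : Torus K n) (a : Fin n → ℤ) (t : Kˣ) (P : Laurent K n) :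
    evalAt (x * cochar a t) P =
      ∑ m ∈ P.coeff.support, P.coeff m * (chr x m : K) * ((t ^ (a ⬝ᵥ m) : Kˣ) : K) := by
  rw [evalAt_eq_sum]
  refine Finset.sum_congr rfl fun m _ => ?_
  rw [chr_mul, chr_cochar, Units.val_mul, mul_assoc]

/-- The polynomial `T^D ∑ cᵢ T^{eᵢ}`. -/
noncomputable def shiftedPoly {ι : Type*} (s : Finset ι) (c : ι → K) (e : ι → ℤ) (D : ℕ) :
    Polynomial K :=
  ∑ i ∈ s, Polynomial.monomial (e i + D).toNat (c i)

theorem eval_shiftedPoly {ι : Type*} (s : Finset ι) (c : ι → K) (e : ι → ℤ) (D : ℕ)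
    (h : ∀ i ∈ s, |e i| ≤ D) (t : Kˣ) :
    (shiftedPoly s c e D).eval (t : K) = (t : K) ^ D * ∑ i ∈ s, c i * ((t ^ e i : Kˣ) : K) := by
  rw [shiftedPoly, Polynomial.eval_finsetSum, Finset.mul_sum]
  refine Finset.sum_congr rfl fun i hi => ?_
  rw [Polynomial.eval_monomial]
  have h1 : ((t ^ (e i + D).toNat : Kˣ) : K) = (t : K) ^ D * ((t ^ e i : Kˣ) : K) := by
    have h2 : ((e i + D).toNat : ℤ) = e i + D := Int.toNat_of_nonneg (by
      have := neg_abs_le (e i); have := h i hi; linarith)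
    rw [← zpow_natCast, h2, zpow_add, zpow_natCast]
    push_cast; ring
  rw [← Units.val_pow_eq_pow_val, h1]; ring

theorem natDegree_shiftedPoly_le {ι : Type*} (s : Finset ι) (c : ι → K) (e : ι → ℤ) (D : ℕ)
    (h : ∀ i ∈ s, |e i| ≤ D) : (shiftedPoly s c e D).natDegree ≤ 2 * D := by
  refine Polynomial.natDegree_sum_le_of_forall_le _ _ fun i hi => ?_
  refine (Polynomial.natDegree_monomial_le _).trans ?_
  have := le_abs_self (e i); have := h i hi
  omega

/-- A nonzero Laurent polynomial in one variable with exponents in `[-D, D]` has at most `2D`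
zeros. -/
theorem zeros_le_of_ne_zero {ι : Type*} (s : Finset ι) (c : ι → K) (e : ι → ℤ) (D : ℕ)
    (h : ∀ i ∈ s, |e i| ≤ D) (hne : ∃ t : Kˣ, ∑ i ∈ s, c i * ((t ^ e i : Kˣ) : K) ≠ 0) :
    {t : Kˣ | ∑ i ∈ s, c i * ((t ^ e i : Kˣ) : K) = 0}.Finite ∧
      {t : Kˣ | ∑ i ∈ s, c i * ((t ^ e i : Kˣ) : K) = 0}.ncard ≤ 2 * D := by
  classical
  set p := shiftedPoly s c e D
  have hp : p ≠ 0 := by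
    obtain ⟨t, ht⟩ := hne
    intro h0
    have := eval_shiftedPoly s c e D h t
    change p.eval (t : K) = _ at this
    rw [h0, Polynomial.eval_zero] at this
    exact mul_ne_zero (pow_ne_zero _ t.ne_zero) ht this.symm
  have hmaps : Set.MapsTo (fun t : Kˣ => (t : K))
      {t : Kˣ | ∑ i ∈ s, c i * ((t ^ e i : Kˣ) : K) = 0} p.roots.toFinset := by
    intro t ht
    simp only [Finset.mem_coe, Multiset.mem_toFinset]
    refine (Polynomial.mem_roots hp).2 ?_
    have := eval_shiftedPoly s c e D h t
    rw [ht, mul_zero] at this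
    exact this
  have hinj : Set.InjOn (fun t : Kˣ => (t : K))
      {t : Kˣ | ∑ i ∈ s, c i * ((t ^ e i : Kˣ) : K) = 0} := fun a _ b _ hab => Units.ext hab
  refine ⟨Set.Finite.of_injOn hmaps hinj (Finset.finite_toSet _), ?_⟩
  refine (Set.ncard_le_ncard_of_injOn _ hmaps hinj (Finset.finite_toSet _)).trans ?_
  rw [Set.ncard_coe_finset]
  exact (Multiset.toFinset_card_le _).trans ((Polynomial.card_roots' _).trans
    (natDegree_shiftedPoly_le s c e D h))

/-- If a Laurent polynomial in one variable vanishes identically, each of its coefficients does. -/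
theorem coeff_eq_zero_of_forall [Infinite K] {ι : Type*} (s : Finset ι) (c : ι → K) (e : ι → ℤ)
    (h : ∀ t : Kˣ, ∑ i ∈ s, c i * ((t ^ e i : Kˣ) : K) = 0) (v : ℤ) :
    ∑ i ∈ s with e i = v, c i = 0 := by
  classical
  obtain ⟨D, hD⟩ : ∃ D : ℕ, ∀ i ∈ s, |e i| ≤ D := by
    refine ⟨∑ i ∈ s, (e i).natAbs, fun i hi => ?_⟩
    rw [Int.abs_eq_natAbs]
    exact_mod_cast Finset.single_le_sum (f := fun i => (e i).natAbs) (fun _ _ => Nat.zero_le _) hi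
  have hp : shiftedPoly s c e D = 0 := by
    refine Polynomial.eq_zero_of_infinite_isRoot _ (Set.Infinite.mono (s := {0}ᶜ) ?_
      (Set.Finite.infinite_compl (Set.finite_singleton 0)))
    intro x hx
    have := eval_shiftedPoly s c e D hD (Units.mk0 x hx)
    rw [h, mul_zero] at this
    exact this
  by_cases hv : ∃ i ∈ s, e i = v
  · obtain ⟨i₀, hi₀, rfl⟩ := hv
    have := congrArg (fun p => p.coeff (e i₀ + D).toNat) hp
    simp only [shiftedPoly, Polynomial.finsetSum_coeff, Polynomial.coeff_monomial,
      Polynomial.coeff_zero] at this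
    rw [← Finset.sum_filter] at this
    rw [← this]
    refine Finset.sum_congr (Finset.filter_congr fun i hi => ?_) fun _ _ => rfl
    have h1 := abs_le.1 (hD i hi)
    have h2 := abs_le.1 (hD i₀ hi₀)
    omega
  · push Not at hv
    rw [Finset.filter_eq_empty_iff.2 fun i hi => hv i hi, Finset.sum_empty]

/-- Up to finitely many choices of `a`, every one-parameter coset on which `P` vanishes identically
is accounted for. -/
theorem exists_finite_directions [Infinite K] (P : Laurent K n) :
    ∃ 𝒜 : Set (Fin n → ℤ), 𝒜.Finite ∧ (∀ a ∈ 𝒜, a ≠ 0) ∧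
      ∀ (x : Torus K n) (a : Fin n → ℤ), a ≠ 0 → (∀ t, evalAt (x * cochar a t) P = 0) →
        ∃ b ∈ 𝒜, ∀ t, evalAt (x * cochar b t) P = 0 := by
  classical
  -- `R a` records which exponents in the support of `P` become equal after pairing with `a`.
  -- Vanishing on the coset means that the coefficients cancel within each class, so it depends on
  -- `a` only through this one of finitely many patterns.
  let R : (Fin n → ℤ) → (P.coeff.support → P.coeff.support → Prop) :=
    fun a m m' => a ⬝ᵥ (m : Fin n → ℤ) = a ⬝ᵥ (m' : Fin n → ℤ)
  have hfin : (R '' {a | a ≠ 0}).Finite := Set.toFinite _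
  choose! b hb hbR using fun r (hr : r ∈ R '' {a | a ≠ 0}) => hr
  refine ⟨b '' (R '' {a | a ≠ 0}), hfin.image b, ?_, fun x a ha hP => ?_⟩
  · rintro _ ⟨r, hr, rfl⟩; exact hb r hr
  · have hr : R a ∈ R '' {a | a ≠ 0} := ⟨a, ha, rfl⟩
    refine ⟨b (R a), ⟨_, hr, rfl⟩, fun t => ?_⟩
    have hRb := hbR _ hr
    set a' := b (R a)
    have hiff : ∀ m ∈ P.coeff.support, ∀ m' ∈ P.coeff.support,
        (a' ⬝ᵥ m = a' ⬝ᵥ m' ↔ a ⬝ᵥ m = a ⬝ᵥ m') := fun m hm m' hm' =>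
      iff_of_eq (congrFun (congrFun hRb ⟨m, hm⟩) ⟨m', hm'⟩)
    have hz := coeff_eq_zero_of_forall P.coeff.support
      (fun m => P.coeff m * (chr x m : K)) (fun m => a ⬝ᵥ m)
      (fun t => by rw [← evalAt_mul_cochar]; exact hP t)
    rw [evalAt_mul_cochar, ← Finset.sum_fiberwise_of_maps_to (t := P.coeff.support.image (a' ⬝ᵥ ·))
      (g := (a' ⬝ᵥ ·)) (fun m hm => Finset.mem_image_of_mem _ hm)]
    refine Finset.sum_eq_zero fun v hv => ?_
    obtain ⟨m₀, hm₀, rfl⟩ := Finset.mem_image.1 hv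
    have h1 : ∑ m ∈ P.coeff.support with a' ⬝ᵥ m = a' ⬝ᵥ m₀, P.coeff m * (chr x m : K) = 0 := by
      rw [← hz (a ⬝ᵥ m₀)]
      exact Finset.sum_congr (Finset.filter_congr fun m hm => hiff m hm m₀ hm₀) fun _ _ => rfl
    rw [Finset.sum_congr rfl (g := fun m => P.coeff m * (chr x m : K) *
      ((t ^ (a' ⬝ᵥ m₀) : Kˣ) : K)) fun m hm => by rw [(Finset.mem_filter.1 hm).2],
      ← Finset.sum_mul, h1, zero_mul]

end OneParameter

/-! ### Dirichlet approximation for torsion points -/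

section Approximation

variable {K : Type*} [Field K] {m : ℕ}

/-- All coordinates lie in the cyclic group of `N`-th roots of unity of `K`. Its generator `ξ` has
order exactly `N`, in any characteristic, since the order of `ζ` divides that of `ξ`. -/
theorem exists_root_zpow {ζ : Torus K m} (hζ : IsOfFinOrder ζ) :
    ∃ (ξ : Kˣ) (b : Fin m → ℕ), orderOf ξ = orderOf ζ ∧ ∀ i, ζ i = ξ ^ b i := by
  set N := orderOf ζ with hN
  have : NeZero N := ⟨hζ.orderOf_pos.ne'⟩
  obtain ⟨ξ, hξ⟩ := IsCyclic.exists_monoid_generator (α := rootsOfUnity N K)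
  have hmem : ∀ i, ζ i ∈ rootsOfUnity N K := fun i => by
    rw [mem_rootsOfUnity]
    exact congrFun (pow_orderOf_eq_one ζ) i
  choose b hb using fun i => Submonoid.mem_powers_iff _ _ |>.1 (hξ ⟨ζ i, hmem i⟩)
  have hb' : ∀ i, ζ i = (ξ : Kˣ) ^ b i := fun i => by
    have := congrArg Subtype.val (hb i)
    simpa using this.symm
  refine ⟨ξ, b, Nat.dvd_antisymm ?_ ?_, hb'⟩
  · exact orderOf_dvd_of_pow_eq_one ((mem_rootsOfUnity _ _).1 ξ.2)
  · refine orderOf_dvd_of_pow_eq_one ?_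
    ext i
    rw [Pi.pow_apply, hb' i, ← pow_mul, mul_comm, pow_mul, pow_orderOf_eq_one]
    simp

/-- Simultaneous approximation by the pigeonhole principle. -/
theorem exists_small_multiple (b : Fin m → ℕ) {N Q : ℕ} (hQ : 0 < Q) (hQN : Q ^ m < N) :
    ∃ k : ℕ, 0 < k ∧ k < N ∧ ∃ a l : Fin m → ℤ, ∀ i, (k : ℤ) * b i = a i + N * l i ∧
      |a i| * Q ≤ N := by
  classical
  have hN : 0 < N := lt_of_le_of_lt (Nat.zero_le _) hQN
  -- `f k i` is the index of the interval, among `Q` of length `1 / Q`, containing the fractional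
  -- part of `k * b i / N`. The `N` values of `k` fall into `Q ^ m < N` boxes, so two of them
  -- collide.
  let f : ℕ → Fin m → ℕ := fun k i => (Q * ((k * b i) % N)) / N
  have hmaps : ∀ k ∈ Finset.range N, f k ∈ Fintype.piFinset fun _ : Fin m => Finset.range Q := by
    intro k _
    rw [Fintype.mem_piFinset]
    intro i
    rw [Finset.mem_range, Nat.div_lt_iff_lt_mul hN]
    exact Nat.mul_lt_mul_of_pos_left (Nat.mod_lt _ hN) hQ
  obtain ⟨x, hx, y, hy, hxy, hf⟩ := Finset.exists_ne_map_eq_of_card_lt_of_maps_to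
    (by simpa using hQN) hmaps
  wlog hlt : x < y generalizing x y
  · exact this y hy x hx hxy.symm hf.symm (lt_of_le_of_ne (not_lt.1 hlt) hxy.symm)
  rw [Finset.mem_range] at hx hy
  refine ⟨y - x, Nat.sub_pos_of_lt hlt, by omega, fun i => ((y * b i % N : ℕ) : ℤ) -
    ((x * b i % N : ℕ) : ℤ), fun i => ((y * b i / N : ℕ) : ℤ) - ((x * b i / N : ℕ) : ℤ),
    fun i => ⟨?_, ?_⟩⟩
  · have h1 : ((y * b i % N : ℕ) : ℤ) + N * ((y * b i / N : ℕ) : ℤ) = y * b i := by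
      exact_mod_cast Nat.mod_add_div (y * b i) N
    have h2 : ((x * b i % N : ℕ) : ℤ) + N * ((x * b i / N : ℕ) : ℤ) = x * b i := by
      exact_mod_cast Nat.mod_add_div (x * b i) N
    rw [Nat.cast_sub hlt.le]
    linear_combination h2 - h1
  · have hfi : Q * (x * b i % N) / N = Q * (y * b i % N) / N := congrFun hf i
    have h1 := Nat.div_add_mod (Q * (x * b i % N)) N
    have h2 := Nat.div_add_mod (Q * (y * b i % N)) N
    have h3 := Nat.mod_lt (Q * (x * b i % N)) hN
    have h4 := Nat.mod_lt (Q * (y * b i % N)) hN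
    rw [hfi] at h1
    zify at h1 h2 h3 h4
    have hr1 : (0 : ℤ) ≤ ((Q * (x * b i % N) % N : ℕ) : ℤ) := Int.natCast_nonneg _
    have hr2 : (0 : ℤ) ≤ ((Q * (y * b i % N) % N : ℕ) : ℤ) := Int.natCast_nonneg _
    push_cast at hr1 hr2 ⊢
    rw [← abs_of_nonneg (Int.natCast_nonneg Q), ← abs_mul, abs_le]
    constructor <;> nlinarith

/-- A torsion point of order `N` lies on a coset of a one-parameter subgroup of small degree by a
point of small order. -/
theorem exists_cochar_of_torsion {ζ : Torus K m} (hζ : IsOfFinOrder ζ) {Q : ℕ} (hQ : 0 < Q)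
    (hQN : Q ^ m < orderOf ζ) :
    ∃ (g : ℕ) (a : Fin m → ℤ) (η : Torus K m) (τ ω : Kˣ), 0 < g ∧ a ≠ 0 ∧
      (∀ i, |a i| * g * Q ≤ orderOf ζ) ∧ η ^ g = 1 ∧ ζ = η * cochar a τ ∧ orderOf ω = g := by
  obtain ⟨ξ, b, hξ, hb⟩ := exists_root_zpow hζ
  set N := orderOf ζ with hN
  have hN0 : 0 < N := hζ.orderOf_pos
  obtain ⟨k, hk0, hkN, a₀, l, hal⟩ := exists_small_multiple b hQ hQN
  set g := Nat.gcd k N with hg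
  have hg0 : 0 < g := Nat.gcd_pos_of_pos_left _ hk0
  obtain ⟨N', hN'⟩ : g ∣ N := Nat.gcd_dvd_right k N
  obtain ⟨k', hk'⟩ : g ∣ k := Nat.gcd_dvd_left k N
  have hga : ∀ i, (g : ℤ) ∣ a₀ i := fun i => by
    have : a₀ i = g * (k' * b i - N' * l i) := by
      have h1 := (hal i).1
      have h2 : (k : ℤ) = g * k' := by exact_mod_cast hk'
      have h3 : (N : ℤ) = g * N' := by exact_mod_cast hN'
      rw [h2, h3] at h1
      linear_combination -h1
    exact ⟨_, this⟩
  choose a ha using hga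
  have hgZ : (g : ℤ) ≠ 0 := by exact_mod_cast hg0.ne'
  have hbez := Nat.gcd_eq_gcd_ab k N
  rw [← hg] at hbez
  set u := Nat.gcdA k N
  set v := Nat.gcdB k N
  -- Multiplying `k * b = g * a + N * l` by `u` and using `g = k * u + N * v` recovers `b`. Hence `ξ
  -- ^ b` splits into a power of `ξ ^ u` with exponent `a` and a power of `ξ ^ N'`, which has order
  -- `g`.
  have hc : ∀ i, (b i : ℤ) = u * a i + N' * (u * l i + v * b i) := fun i => by
    have h1 := (hal i).1
    have h3 : (N : ℤ) = g * N' := by exact_mod_cast hN'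
    apply mul_left_cancel₀ hgZ
    rw [ha i] at h1
    linear_combination (b i : ℤ) * hbez + u * h1 + (u * l i + v * b i) * h3
  refine ⟨g, a, fun i => (ξ ^ N') ^ (u * l i + v * b i), ξ ^ u, ξ ^ N', hg0, ?_, ?_, ?_, ?_, ?_⟩
  -- If `a = 0` then `ζ ^ k = 1` with `0 < k < N`.
  · rintro rfl
    have hk1 : ζ ^ k = 1 := by
      ext i
      have h1 := (hal i).1
      rw [ha i] at h1
      simp only [Pi.zero_apply, mul_zero, zero_add] at h1
      rw [Pi.pow_apply, hb i, ← pow_mul, ← zpow_natCast]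
      have h2 : ((b i * k : ℕ) : ℤ) = N * l i := by push_cast; linarith
      rw [h2, zpow_mul, zpow_natCast, ← hξ, pow_orderOf_eq_one]
      simp
    exact absurd (Nat.le_of_dvd hk0 (orderOf_dvd_of_pow_eq_one hk1)) (not_le.2 hkN)
  · intro i
    have := (hal i).2
    rw [ha i, abs_mul, abs_of_nonneg (Int.natCast_nonneg g)] at this
    linarith
  · ext i
    rw [Pi.pow_apply, ← zpow_natCast, ← zpow_mul, mul_comm, zpow_mul, zpow_natCast, ← pow_mul,
      mul_comm N' g, ← hN', ← hξ, pow_orderOf_eq_one]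
    simp
  · ext i
    rw [Pi.mul_apply, hb i, cochar, ← zpow_natCast, ← zpow_mul, ← zpow_natCast, ← zpow_mul,
      ← zpow_add]
    congr 2
    linear_combination hc i
  · have hdvd : N' ∣ orderOf ξ := by rw [hξ, hN']; exact Dvd.intro_left g rfl
    have hN_ne : N' ≠ 0 := by rintro rfl; simp [hN'] at hN0
    rw [orderOf_pow_of_dvd hN_ne hdvd, hξ, hN', Nat.mul_div_cancel _ (Nat.pos_of_ne_zero hN_ne)]

end Approximation

/-! ### Isolated torsion points on a hypersurface -/

section HypersurfaceCount

variable {K : Type*} [Field K] {m : ℕ}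

/-- Bound on the exponents of `P` in terms of `a`. -/
theorem exists_dotProduct_bound (P : Laurent K m) :
    ∃ D : ℕ, ∀ (a : Fin m → ℤ) (A : ℕ), (∀ i, |a i| ≤ A) →
      ∀ μ ∈ P.coeff.support, |a ⬝ᵥ μ| ≤ (D * A : ℕ) := by
  classical
  refine ⟨∑ μ ∈ P.coeff.support, ∑ i, (μ i).natAbs, fun a A hA μ hμ => ?_⟩
  calc |a ⬝ᵥ μ| ≤ ∑ i, |a i * μ i| := Finset.abs_sum_le_sum_abs _ _
    _ ≤ ∑ i, (A : ℤ) * (μ i).natAbs := by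
        refine Finset.sum_le_sum fun i _ => ?_
        rw [abs_mul, Int.abs_eq_natAbs (μ i)]
        exact mul_le_mul_of_nonneg_right (hA i) (Int.natCast_nonneg _)
    _ = (((∑ i, (μ i).natAbs) * A : ℕ) : ℤ) := by push_cast; rw [← Finset.mul_sum]; ring
    _ ≤ _ := by
        have := Finset.single_le_sum (f := fun μ : Fin m → ℤ => ∑ i, (μ i).natAbs)
          (fun _ _ => Nat.zero_le _) hμ
        exact_mod_cast Nat.mul_le_mul_right A this

/-- The zeros of `P` on the cosets by `g`-torsion points of the one-parameter subgroup of
direction `a`. -/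
def cosetZeros (P : Laurent K m) (g : ℕ) (a : Fin m → ℤ) : Set (Torus K m) :=
  {ζ | evalAt ζ P = 0 ∧ (∃ t, evalAt (ζ * cochar a t) P ≠ 0) ∧
    ∃ (η : Torus K m) (τ ω : Kˣ), η ^ g = 1 ∧ ζ = η * cochar a τ ∧ orderOf ω = g}

/-- Count pairs `(η, τ)`: at most `g ^ m` choices of `η`, and at most `2 * D * A` zeros on each
coset. Every point arises from at least `g` pairs, and this factor `g` is what later makes the sum
over `g` converge instead of growing like a logarithm. -/
theorem ncard_cosetZeros_le (P : Laurent K m) {D : ℕ}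
    (hD : ∀ (a : Fin m → ℤ) (A : ℕ), (∀ i, |a i| ≤ A) →
      ∀ μ ∈ P.coeff.support, |a ⬝ᵥ μ| ≤ (D * A : ℕ)) {g : ℕ} (hg : 0 < g) {a : Fin m → ℤ} {A : ℕ}
    (hA : ∀ i, |a i| ≤ A) :
    (cosetZeros P g a).Finite ∧ g * (cosetZeros P g a).ncard ≤ g ^ m * (2 * (D * A)) := by
  classical
  let pairs : Set (Torus K m × Kˣ) := {p | p.1 ^ g = 1 ∧ evalAt (p.1 * cochar a p.2) P = 0 ∧
    ∃ t, evalAt (p.1 * cochar a t) P ≠ 0}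
  have hroots := finite_pow_eq_one (K := K) m hg
  have hfib : ∀ η : Torus K m, {p ∈ pairs | p.1 = η}.Finite ∧
      {p ∈ pairs | p.1 = η}.ncard ≤ 2 * (D * A) := by
    intro η
    by_cases hη : ∃ t, evalAt (η * cochar a t) P ≠ 0
    · have hz := zeros_le_of_ne_zero P.coeff.support (fun μ => P.coeff μ * (chr η μ : K))
        (fun μ => a ⬝ᵥ μ) (D * A) (hD a A hA)
        (by obtain ⟨t, ht⟩ := hη; exact ⟨t, by rwa [← evalAt_mul_cochar]⟩)
      simp_rw [← evalAt_mul_cochar] at hz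
      have hmaps : Set.MapsTo Prod.snd {p ∈ pairs | p.1 = η}
          {t : Kˣ | evalAt (η * cochar a t) P = 0} := by
        rintro p ⟨hp, rfl⟩; exact hp.2.1
      have hinj : Set.InjOn Prod.snd {p ∈ pairs | p.1 = η} := by
        rintro p ⟨-, hp⟩ q ⟨-, hq⟩ h
        exact Prod.ext (hp.trans hq.symm) h
      exact ⟨Set.Finite.of_injOn hmaps hinj hz.1,
        (Set.ncard_le_ncard_of_injOn _ hmaps hinj hz.1).trans hz.2⟩
    · have : {p ∈ pairs | p.1 = η} = ∅ := by
        ext p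
        simp only [Set.mem_ofPred_eq, Set.mem_empty_iff_false, iff_false]
        rintro ⟨hp, rfl⟩
        exact hη hp.2.2
      rw [this]; simp
  have hpairs_fin : pairs.Finite := by
    refine Set.Finite.subset (Set.Finite.biUnion hroots.1 fun η _ => (hfib η).1) ?_
    intro p hp
    simp only [Set.mem_iUnion]
    exact ⟨p.1, hp.1, hp, rfl⟩
  have hpairs : pairs.ncard ≤ g ^ m * (2 * (D * A)) := by
    refine (ncard_le_mul_ncard_of_fiber Prod.fst hroots.1 (fun p hp => hp.1) hpairs_fin
      fun η _ => (hfib η).2).trans ?_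
    rw [mul_comm]
    exact Nat.mul_le_mul_right _ hroots.2
  let f : Torus K m × Kˣ → Torus K m := fun p => p.1 * cochar a p.2
  have hsurj : ∀ ζ ∈ cosetZeros P g a, g ≤ {p ∈ pairs | f p = ζ}.ncard := by
    rintro ζ ⟨hζ0, ⟨t, ht⟩, η, τ, ω, hη, rfl, hω⟩
    have hω1 : ω ^ g = 1 := hω ▸ pow_orderOf_eq_one ω
    -- A power of `ω` can be moved from `τ` to `η` without changing the point or `η ^ g = 1`; the
    -- `g` powers give different `τ`.
    let h : Fin g → Torus K m × Kˣ := fun j => (η * cochar a (ω ^ (j : ℕ))⁻¹, τ * ω ^ (j : ℕ))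
    have hinj : Function.Injective h := by
      intro i j hij
      have h1 : ω ^ (i : ℕ) = ω ^ (j : ℕ) := mul_left_cancel (Prod.ext_iff.1 hij).2
      exact Fin.ext (pow_injOn_Iio_orderOf (by simp [hω]) (by simp [hω]) h1)
    have hfh : ∀ j, f (h j) = η * cochar a τ := by
      intro j
      simp only [f, h]
      rw [mul_assoc, ← cochar_mul]
      congr 2
      rw [mul_comm τ, inv_mul_cancel_left]
    have hmem : Set.range h ⊆ {p ∈ pairs | f p = η * cochar a τ} := by
      rintro _ ⟨j, rfl⟩
      refine ⟨⟨?_, ?_, τ * t * ω ^ (j : ℕ), ?_⟩, hfh j⟩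
      · change (η * cochar a (ω ^ (j : ℕ))⁻¹) ^ g = 1
        rw [mul_pow, hη, one_mul]
        ext i
        rw [Pi.pow_apply, cochar, ← zpow_natCast, ← zpow_mul, mul_comm, zpow_mul, zpow_natCast, inv_pow, ← pow_mul,
          mul_comm, pow_mul, hω1]
        simp
      · exact (congrArg (fun x => evalAt x P) (hfh j)).trans hζ0
      · change evalAt (η * cochar a (ω ^ (j : ℕ))⁻¹ * cochar a (τ * t * ω ^ (j : ℕ))) P ≠ 0
        rw [mul_assoc, ← cochar_mul, mul_comm (τ * t), inv_mul_cancel_left, cochar_mul, ← mul_assoc]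
        exact ht
    have := Set.ncard_le_ncard hmem (hpairs_fin.subset fun p hp => hp.1)
    rwa [Set.ncard_range_of_injective hinj, Nat.card_eq_fintype_card, Fintype.card_fin] at this
  have hfin : (cosetZeros P g a).Finite := by
    refine (hpairs_fin.image f).subset ?_
    rintro ζ hζ
    have := hsurj ζ hζ
    have hne : {p ∈ pairs | f p = ζ}.Nonempty := by
      rw [Set.nonempty_iff_ne_empty]
      intro h
      rw [h, Set.ncard_empty] at this
      omega
    obtain ⟨p, hp, hpζ⟩ := hne
    exact ⟨p, hp, hpζ⟩
  refine ⟨hfin, le_trans ?_ hpairs⟩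
  lift pairs to Finset (Torus K m × Kˣ) using hpairs_fin with S hS
  set Z := hfin.toFinset with hZ
  have hZc : (cosetZeros P g a).ncard = Z.card := Set.ncard_eq_toFinset_card _ hfin
  rw [hZc, Set.ncard_coe_finset]
  calc g * Z.card = ∑ ζ ∈ Z, g := by simp [mul_comm]
    _ ≤ ∑ ζ ∈ Z, (S.filter fun p => f p = ζ).card := by
        refine Finset.sum_le_sum fun ζ hζ => ?_
        refine (hsurj ζ ((Set.Finite.mem_toFinset _).1 hζ)).trans (le_of_eq ?_)
        rw [← Set.ncard_coe_finset]
        congr 1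
        ext p; simp
    _ = (S.filter fun p => f p ∈ Z).card := by
        rw [Finset.card_eq_sum_card_fiberwise (f := f) (s := S.filter fun p => f p ∈ Z) (t := Z)
          (fun p hp => (Finset.mem_filter.1 hp).2)]
        refine Finset.sum_congr rfl fun ζ hζ => ?_
        congr 1
        ext p
        simp only [Finset.mem_filter]
        constructor
        · rintro ⟨h1, rfl⟩; exact ⟨⟨h1, hζ⟩, rfl⟩
        · rintro ⟨⟨h1, -⟩, h2⟩; exact ⟨h1, h2⟩
    _ ≤ S.card := Finset.card_filter_le _ _

/-- `Q` is the largest integer with `Q ^ m < N`, so that `N / Q` is about `N ^ (1 - 1/m)`; `2 ≤ N`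
makes it positive. -/
theorem exists_pow_lt_le {m N : ℕ} (hm : 0 < m) (hN : 2 ≤ N) :
    ∃ Q : ℕ, 0 < Q ∧ Q ^ m < N ∧ N ≤ (Q + 1) ^ m := by
  have hex : ∃ q : ℕ, N ≤ (q + 1) ^ m := ⟨N, (Nat.le_succ N).trans (Nat.le_self_pow hm.ne' _)⟩
  classical
  refine ⟨Nat.find hex, ?_, ?_, Nat.find_spec hex⟩
  · rw [Nat.pos_iff_ne_zero]
    intro h
    have := Nat.find_spec hex
    rw [h] at this
    simp at this
    omega
  · have h0 : Nat.find hex ≠ 0 := by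
      intro h
      have := Nat.find_spec hex
      rw [h] at this
      simp at this
      omega
    obtain ⟨q, hq⟩ := Nat.exists_eq_succ_of_ne_zero h0
    have := Nat.find_min hex (m := q) (by omega)
    rw [hq]
    exact not_le.1 this

/-- Torsion points on the hypersurface `P = 0` which do not lie on a one-parameter coset contained
in it. -/
theorem torsionBound_isolated (hm : 0 < m) (P : Laurent K m) :
    TorsionBound {ζ : Torus K m | evalAt ζ P = 0 ∧
      ∀ a : Fin m → ℤ, a ≠ 0 → ∃ t, evalAt (ζ * cochar a t) P ≠ 0} ((m : ℝ) - 1 / m) := by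
  classical
  obtain ⟨D, hD⟩ := exists_dotProduct_bound P
  set E := {ζ : Torus K m | evalAt ζ P = 0 ∧
      ∀ a : Fin m → ℤ, a ≠ 0 → ∃ t, evalAt (ζ * cochar a t) P ≠ 0} with hE
  have hsum : Summable fun g : ℕ => 1 / (g : ℝ) ^ 2 := Real.summable_one_div_nat_pow.2 one_lt_two
  set S := ∑' g : ℕ, 1 / (g : ℝ) ^ 2
  have hmR : (0 : ℝ) < m := by exact_mod_cast hm
  have hm1 : (1 : ℝ) ≤ m := by exact_mod_cast hm
  refine ⟨1 + 2 * D * 3 ^ m * 2 ^ (m + 1) * S, fun T hT => ?_⟩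
  have hT0 : 0 < T := by linarith
  -- `B` bounds `N / Q` for every order `N ≤ T`; the factor `2` comes from `Q + 1 ≤ 2 * Q`.
  set B : ℝ := 2 * T ^ (1 - 1 / (m : ℝ)) with hB
  have hB0 : 0 ≤ B := by positivity
  let A : ℕ → ℕ := fun g => ⌊B / g⌋₊
  let box : ℕ → Finset (Fin m → ℤ) := fun g =>
    Fintype.piFinset fun _ => Finset.Icc (-(A g : ℤ)) (A g)
  let U : Set (Torus K m) := ⋃ g ∈ Finset.Icc 1 ⌊B⌋₊, ⋃ a ∈ box g, cosetZeros P g a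
  have hbox : ∀ g, ∀ a ∈ box g, ∀ i, |a i| ≤ A g := by
    intro g a ha i
    have := Finset.mem_Icc.1 (Fintype.mem_piFinset.1 ha i)
    exact abs_le.2 this
  have hsub : torsionUpTo E T ⊆ {1} ∪ U := by
    rintro ζ ⟨⟨hζ0, hζ1⟩, hfin, hord⟩
    by_cases h1 : ζ = 1
    · exact Or.inl h1
    right
    have hN1 : orderOf ζ ≠ 1 := fun h => h1 (orderOf_eq_one_iff.1 h)
    have hN0 := hfin.orderOf_pos
    obtain ⟨Q, hQ0, hQ1, hQ2⟩ := exists_pow_lt_le hm (show 2 ≤ orderOf ζ by omega)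
    obtain ⟨g, a, η, τ, ω, hg, ha, haQ, hη, hζ, hω⟩ := exists_cochar_of_torsion hfin hQ0 hQ1
    have hQR : (0 : ℝ) < Q := by exact_mod_cast hQ0
    have hgR : (0 : ℝ) < g := by exact_mod_cast hg
    have hNR : (0 : ℝ) < orderOf ζ := by exact_mod_cast hN0
    have hNQ : (orderOf ζ : ℝ) ≤ B * Q := by
      have h2 : (orderOf ζ : ℝ) ^ (1 / (m : ℝ)) ≤ Q + 1 := by
        have h3 : (orderOf ζ : ℝ) ≤ ((Q : ℝ) + 1) ^ m := by exact_mod_cast hQ2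
        calc (orderOf ζ : ℝ) ^ (1 / (m : ℝ)) ≤ (((Q : ℝ) + 1) ^ m) ^ (1 / (m : ℝ)) :=
              Real.rpow_le_rpow hNR.le h3 (by positivity)
          _ = Q + 1 := by
              rw [one_div, Real.pow_rpow_inv_natCast (by positivity) hm.ne']
      have h4 : (Q : ℝ) + 1 ≤ 2 * Q := by
        have : (1 : ℝ) ≤ Q := by exact_mod_cast hQ0
        linarith
      have h5 : (orderOf ζ : ℝ) ^ (1 - 1 / (m : ℝ)) ≤ T ^ (1 - 1 / (m : ℝ)) := by
        refine Real.rpow_le_rpow hNR.le hord ?_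
        rw [sub_nonneg, div_le_one hmR]; exact hm1
      calc (orderOf ζ : ℝ) = (orderOf ζ : ℝ) ^ (1 - 1 / (m : ℝ)) *
            (orderOf ζ : ℝ) ^ (1 / (m : ℝ)) := by
              rw [← Real.rpow_add hNR]; simp
        _ ≤ T ^ (1 - 1 / (m : ℝ)) * (2 * Q) := by
              gcongr; exact h2.trans h4
        _ = B * Q := by rw [hB]; ring
    have hag : ∀ i, ((|a i| : ℤ) : ℝ) * g ≤ B := by
      intro i
      have h2 : ((|a i| : ℤ) : ℝ) * g * Q ≤ orderOf ζ := by exact_mod_cast haQ i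
      exact le_of_mul_le_mul_right (h2.trans hNQ) hQR
    -- Some `|a i|` is at least `1`, so the bound on `|a i| * g` also bounds `g`.
    have hgB : (g : ℝ) ≤ B := by
      obtain ⟨i, hi⟩ := Function.ne_iff.1 ha
      have h2 : (1 : ℝ) ≤ ((|a i| : ℤ) : ℝ) := by
        exact_mod_cast Int.one_le_abs hi
      nlinarith [hag i]
    simp only [U, Set.mem_iUnion]
    refine ⟨g, Finset.mem_Icc.2 ⟨hg, Nat.le_floor hgB⟩, a, ?_, hζ0, hζ1 a ha, η, τ, ω, hη, hζ, hω⟩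
    refine Fintype.mem_piFinset.2 fun i => Finset.mem_Icc.2 (abs_le.1 ?_)
    have h2 : ((a i).natAbs : ℝ) ≤ B / g := by
      rw [le_div_iff₀ hgR, Nat.cast_natAbs]; exact hag i
    have h3 : (a i).natAbs ≤ A g := Nat.le_floor h2
    rw [Int.abs_eq_natAbs]
    exact_mod_cast h3
  have hgpos : ∀ g ∈ Finset.Icc 1 ⌊B⌋₊, 0 < g := fun g hg => (Finset.mem_Icc.1 hg).1
  have hUfin : U.Finite := Set.Finite.biUnion (Finset.finite_toSet _) fun g hg =>
    Set.Finite.biUnion (Finset.finite_toSet _) fun a ha =>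
      (ncard_cosetZeros_le P hD (hgpos g hg) (hbox g a ha)).1
  have hterm : ∀ g ∈ Finset.Icc 1 ⌊B⌋₊, ((⋃ a ∈ box g, cosetZeros P g a).ncard : ℝ) ≤
      2 * D * 3 ^ m * B ^ (m + 1) * (1 / (g : ℝ) ^ 2) := by
    intro g hg
    have hg0 := hgpos g hg
    have hgR : (0 : ℝ) < g := by exact_mod_cast hg0
    have hgB : (g : ℝ) ≤ B := (Nat.le_floor_iff hB0).1 (Finset.mem_Icc.1 hg).2
    have hA1 : 1 ≤ A g := Nat.le_floor (by rw [Nat.cast_one, one_le_div hgR]; exact hgB)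
    have hAB : (A g : ℝ) ≤ B / g := Nat.floor_le (by positivity)
    have hone : ∀ a ∈ box g, ((cosetZeros P g a).ncard : ℝ) ≤ (g : ℝ) ^ m / g * (2 * D * (B / g)) := by
      intro a ha
      have h1 := (ncard_cosetZeros_le P hD hg0 (hbox g a ha)).2
      have h2 : (g : ℝ) * (cosetZeros P g a).ncard ≤ (g : ℝ) ^ m * (2 * (D * A g)) := by
        exact_mod_cast h1
      have h3 : (g : ℝ) * (cosetZeros P g a).ncard ≤ (g : ℝ) ^ m * (2 * (D * (B / g))) :=
        h2.trans (by gcongr)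
      rw [div_mul_eq_mul_div, le_div_iff₀ hgR]
      linarith
    have hcard : ((box g).card : ℝ) ≤ (3 * (B / g)) ^ m := by
      rw [Fintype.card_piFinset_const, Int.card_Icc]
      push_cast
      gcongr
      have h1 : ((A g : ℤ) + 1 - -(A g : ℤ)).toNat = 2 * A g + 1 := by omega
      rw [h1]
      push_cast
      have : (1 : ℝ) ≤ A g := by exact_mod_cast hA1
      linarith
    calc ((⋃ a ∈ box g, cosetZeros P g a).ncard : ℝ)
        ≤ ∑ a ∈ box g, ((cosetZeros P g a).ncard : ℝ) := by
          exact_mod_cast Finset.set_ncard_biUnion_le _ _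
      _ ≤ (box g).card • ((g : ℝ) ^ m / g * (2 * D * (B / g))) :=
          Finset.sum_le_card_nsmul _ _ _ hone
      _ = (box g).card * ((g : ℝ) ^ m / g * (2 * D * (B / g))) := by rw [nsmul_eq_mul]
      _ ≤ (3 * (B / g)) ^ m * ((g : ℝ) ^ m / g * (2 * D * (B / g))) := by gcongr
      -- The powers of `g` combine to `g ^ (-m) * g ^ (m - 1) * g ^ (-1) = g ^ (-2)`.
      _ = 2 * D * 3 ^ m * B ^ (m + 1) * (1 / (g : ℝ) ^ 2) := by
          rw [mul_pow, div_pow]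
          field_simp
          ring
  have hUcard : (U.ncard : ℝ) ≤ 2 * D * 3 ^ m * B ^ (m + 1) * S := by
    calc (U.ncard : ℝ) ≤ ∑ g ∈ Finset.Icc 1 ⌊B⌋₊, ((⋃ a ∈ box g, cosetZeros P g a).ncard : ℝ) := by
          exact_mod_cast Finset.set_ncard_biUnion_le _ _
      _ ≤ ∑ g ∈ Finset.Icc 1 ⌊B⌋₊, 2 * D * 3 ^ m * B ^ (m + 1) * (1 / (g : ℝ) ^ 2) :=
          Finset.sum_le_sum hterm
      _ ≤ 2 * D * 3 ^ m * B ^ (m + 1) * S := by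
          rw [← Finset.mul_sum]
          gcongr
          exact hsum.sum_le_tsum _ fun _ _ => by positivity
  -- `(1 - 1/m) * (m + 1) = m - 1/m`.
  have hBpow : B ^ (m + 1) = 2 ^ (m + 1) * T ^ ((m : ℝ) - 1 / m) := by
    rw [hB, mul_pow, ← Real.rpow_natCast (T ^ _), ← Real.rpow_mul hT0.le]
    congr 2
    push_cast
    field_simp
    ring
  have hTe : 1 ≤ T ^ ((m : ℝ) - 1 / m) := by
    refine Real.one_le_rpow hT ?_
    have : 1 / (m : ℝ) ≤ 1 := by rw [div_le_one hmR]; exact hm1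
    linarith
  calc ((torsionUpTo E T).ncard : ℝ) ≤ (({1} ∪ U : Set (Torus K m)).ncard : ℝ) := by
        exact_mod_cast Set.ncard_le_ncard hsub ((Set.finite_singleton _).union hUfin)
    _ ≤ 1 + U.ncard := by
        have := Set.ncard_union_le {(1 : Torus K m)} U
        rw [Set.ncard_singleton] at this
        exact_mod_cast this
    _ ≤ 1 * T ^ ((m : ℝ) - 1 / m) +
        2 * D * 3 ^ m * (2 ^ (m + 1) * T ^ ((m : ℝ) - 1 / m)) * S := by
        rw [← hBpow, one_mul]; exact add_le_add hTe hUcard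
    _ = (1 + 2 * D * 3 ^ m * 2 ^ (m + 1) * S) * T ^ ((m : ℝ) - 1 / m) := by ring

end HypersurfaceCount

/-! ### Multiplicative relations modulo constants -/

section RelationLattice

variable {K : Type*} [Field K] {n k : ℕ}

/-- The lattice of exponents `m` such that `x^m` is constant on `X`. -/
def relLattice (X : Set (Torus K n)) : Submodule ℤ (Fin n → ℤ) where
  carrier := {m | ∃ c : Kˣ, ∀ x ∈ X, chr x m = c}
  zero_mem' := ⟨1, fun x _ => chr_zero x⟩
  add_mem' := by
    rintro m m' ⟨c, hc⟩ ⟨c', hc'⟩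
    exact ⟨c * c', fun x hx => by rw [chr_add, hc x hx, hc' x hx]⟩
  smul_mem' := by
    rintro z m ⟨c, hc⟩
    exact ⟨c ^ z, fun x hx => by rw [chr_smul, hc x hx]⟩

theorem mem_relLattice {X : Set (Torus K n)} {m : Fin n → ℤ} :
    m ∈ relLattice X ↔ ∃ c : Kˣ, ∀ x ∈ X, chr x m = c := Iff.rfl

theorem isClosed_chr_eq (m : Fin n → ℤ) (c : Kˣ) : IsClosed {x : Torus K n | chr x m = c} := by
  convert isClosed_setOf_evalAt (AddMonoidAlgebra.single m (1 : K) - algebraMap K _ (c : K)) using 1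
  ext x
  simp [evalAt_single, sub_eq_zero, Units.val_inj]

theorem relLattice_closure (X : Set (Torus K n)) : relLattice (closure X) = relLattice X := by
  ext m
  refine ⟨fun ⟨c, hc⟩ => ⟨c, fun x hx => hc x (subset_closure hx)⟩, fun ⟨c, hc⟩ => ⟨c, ?_⟩⟩
  exact fun x hx => closure_minimal (t := {x | chr x m = c}) hc (isClosed_chr_eq m c) hx

/-- The action of an integer matrix on exponents. -/
def expMap (B : Fin k → Fin n → ℤ) : (Fin k → ℤ) →ₗ[ℤ] (Fin n → ℤ) :=
  Fintype.linearCombination ℤ B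

theorem expMap_apply (B : Fin k → Fin n → ℤ) (m : Fin k → ℤ) : expMap B m = ∑ j, m j • B j := rfl

theorem relLattice_image (B : Fin k → Fin n → ℤ) (X : Set (Torus K n)) :
    relLattice (monoMap B '' X) = (relLattice X).comap (expMap B) := by
  ext m
  simp [mem_relLattice, chr_monoMap, expMap_apply]

/-- Separating positive from negative exponents turns a nontrivial relation into a nonzero binomial
in the independent coordinates that vanishes on `X`. -/
theorem eq_zero_of_mem_relLattice {X : Set (Torus K n)} {s : ℕ} {σ : Fin s → Fin n}
    (hσ : AlgebraicIndependent K fun j => mon X (Pi.single (σ j) 1)) {c : Fin s → ℤ}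
    (hc : ∑ j, c j • Pi.single (σ j) (1 : ℤ) ∈ relLattice X) : c = 0 := by
  classical
  obtain ⟨u, hu⟩ := hc
  by_contra hc0
  let cp : Fin s →₀ ℕ := Finsupp.equivFunOnFinite.symm fun j => (c j).toNat
  let cn : Fin s →₀ ℕ := Finsupp.equivFunOnFinite.symm fun j => (-c j).toNat
  have hne : cn ≠ cp := by
    intro h
    apply hc0
    ext j
    have := DFunLike.congr_fun h j
    simp only [cp, cn, Finsupp.equivFunOnFinite_symm_apply_apply] at this
    simp only [Pi.zero_apply]
    omega
  have hp : MvPolynomial.monomial cp (1 : K) - MvPolynomial.monomial cn (u : K) ≠ 0 := by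
    intro h
    have := congrArg (MvPolynomial.coeff cp) h
    simp [MvPolynomial.coeff_monomial, hne] at this
  obtain ⟨x, hx, hx'⟩ := exists_eval_ne_zero hσ hp
  apply hx'
  have h1 := hu x hx
  rw [chr_sum] at h1
  simp only [chr_smul, chr_single, zpow_one] at h1
  have h2 : ∏ j, x (σ j) ^ cp j = u * ∏ j, x (σ j) ^ cn j := by
    rw [← h1, ← Finset.prod_mul_distrib]
    refine Finset.prod_congr rfl fun j _ => ?_
    rw [← zpow_natCast, ← zpow_natCast, ← zpow_add]
    congr 1
    simp only [cp, cn, Finsupp.equivFunOnFinite_symm_apply_apply]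
    omega
  have h3 := congrArg (Units.val) h2
  simp only [Units.coe_prod, Units.val_mul, Units.val_pow_eq_pow_val] at h3
  simp only [map_sub, MvPolynomial.eval_monomial, chr_single, zpow_one, one_mul]
  rw [Finsupp.prod_fintype _ _ (by simp), Finsupp.prod_fintype _ _ (by simp), h3, sub_self]

theorem sum_smul_single_apply {s : ℕ} {σ : Fin s → Fin n} (hσ : Function.Injective σ)
    (c : Fin s → ℤ) (j : Fin s) : (∑ i, c i • Pi.single (σ i) (1 : ℤ) : Fin n → ℤ) (σ j) = c j := by
  classical
  rw [Finset.sum_apply, Finset.sum_eq_single j]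
  · simp
  · intro i _ hij
    simp [hσ.ne hij.symm]
  · simp

theorem sum_smul_single_apply_of_notMem {s : ℕ} {σ : Fin s → Fin n} (c : Fin s → ℤ) {j : Fin n}
    (hj : j ∉ Set.range σ) : (∑ i, c i • Pi.single (σ i) (1 : ℤ) : Fin n → ℤ) j = 0 := by
  classical
  rw [Finset.sum_apply]
  refine Finset.sum_eq_zero fun i _ => ?_
  have : j ≠ σ i := fun h => hj ⟨i, h.symm⟩
  simp [this]

theorem card_compl_range {s : ℕ} {σ : Fin s → Fin n} (hσ : Function.Injective σ) :
    Nat.card {j // j ∉ Set.range σ} + s = n := by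
  classical
  have h1 := Fintype.card_subtype_compl (fun j => j ∈ Set.range σ)
  have h2 : Fintype.card {j // j ∈ Set.range σ} = s := by
    rw [← Nat.card_eq_fintype_card]
    exact (Nat.card_range_of_injective hσ).trans (by simp)
  have h3 := Fintype.card_subtype_le (fun j => j ∈ Set.range σ)
  rw [Nat.card_eq_fintype_card]
  rw [h2, Fintype.card_fin] at h1 h3
  omega

/-- A relation supported on the transcendence basis is trivial, so restricting relations to the
remaining `n - tr X` coordinates is injective. -/
theorem tr_add_finrank_le {X : Set (Torus K n)} (hX : IsIrreducible X) :
    tr X + Module.finrank ℤ (relLattice X) ≤ n := by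
  classical
  obtain ⟨σ, hinj, hσ⟩ := exists_coords_isTranscendenceBasis hX
  let r : relLattice X →ₗ[ℤ] ({j // j ∉ Set.range σ} → ℤ) :=
    (LinearMap.funLeft ℤ ℤ Subtype.val).comp (relLattice X).subtype
  have hr : Function.Injective r := by
    rw [injective_iff_map_eq_zero]
    rintro ⟨m, hm⟩ h0
    have hm0 : ∀ j, j ∉ Set.range σ → m j = 0 := fun j hj => congrFun h0 ⟨j, hj⟩
    have hsum : m = ∑ i, m (σ i) • Pi.single (σ i) (1 : ℤ) := by
      ext j
      by_cases hj : j ∈ Set.range σ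
      · obtain ⟨i, rfl⟩ := hj
        rw [sum_smul_single_apply hinj (fun i => m (σ i))]
      · rw [hm0 j hj, sum_smul_single_apply_of_notMem _ hj]
    have hz := eq_zero_of_mem_relLattice hσ.1 (c := fun i => m (σ i)) (by rwa [← hsum])
    ext j
    change m j = 0
    by_cases hj : j ∈ Set.range σ
    · obtain ⟨i, rfl⟩ := hj
      exact congrFun hz i
    · exact hm0 j hj
  have h1 := LinearMap.finrank_le_finrank_of_injective hr
  rw [Module.finrank_fintype_fun_eq_card, ← Nat.card_eq_fintype_card] at h1
  have := card_compl_range hinj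
  omega

/-- If `X` is not a coset, a transcendence basis of coordinates can be extended by a coordinate to
a family without multiplicative relations modulo constants. -/
theorem exists_snoc_independent {X : Set (Torus K n)} {s : ℕ} {σ : Fin s → Fin n}
    (hinj : Function.Injective σ)
    (hσ : AlgebraicIndependent K fun j => mon X (Pi.single (σ j) 1))
    (hnc : s + Module.finrank ℤ (relLattice X) < n) :
    ∃ j : Fin n, ∀ c : Fin (s + 1) → ℤ,
      ∑ i, c i • Pi.single (Fin.snoc (α := fun _ => Fin n) σ j i) (1 : ℤ) ∈ relLattice X →
        c = 0 := by
  classical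
  by_contra! hcon
  choose c hc hc0 using hcon
  have hlast : ∀ j, c j (Fin.last s) ≠ 0 := by
    intro j h0
    apply hc0 j
    have h1 := hc j
    rw [Fin.sum_univ_castSucc] at h1
    simp only [Fin.snoc_castSucc, Fin.snoc_last, h0, zero_smul, add_zero] at h1
    have h2 := eq_zero_of_mem_relLattice hσ (c := fun i => c j i.castSucc) h1
    ext i
    refine Fin.lastCases h0 (fun i => ?_) i
    exact congrFun h2 i
  -- If every coordinate were dependent on the basis, these relations, diagonal with nonzero entries
  -- outside `σ`, would give rank at least `n - s`.
  let v : {j // j ∉ Set.range σ} → relLattice X := fun j => ⟨_, hc j⟩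
  have hv : ∀ j j' : {j // j ∉ Set.range σ}, (v j : Fin n → ℤ) j' =
      if j = j' then c j (Fin.last s) else 0 := by
    intro j j'
    change (∑ i, c j i • Pi.single (Fin.snoc (α := fun _ => Fin n) σ (j : Fin n) i) (1 : ℤ) :
      Fin n → ℤ) _ = _
    rw [Fin.sum_univ_castSucc]
    simp only [Fin.snoc_castSucc, Fin.snoc_last, Pi.add_apply]
    rw [sum_smul_single_apply_of_notMem (fun i => c j i.castSucc) j'.2, zero_add]
    by_cases h : j = j'
    · subst h; simp
    · have : (j' : Fin n) ≠ j := fun h' => h (Subtype.ext h'.symm)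
      simp [this, h]
  have hli : LinearIndependent ℤ v := by
    rw [Fintype.linearIndependent_iff]
    intro d hd j
    have h1 := congrFun (congrArg Subtype.val hd) (j : Fin n)
    simp only [AddSubmonoidClass.coe_finsetSum, Finset.sum_apply, Submodule.coe_smul,
      Pi.smul_apply, hv, smul_eq_mul, mul_ite, mul_zero, Finset.sum_ite_eq',
      Finset.mem_univ, if_true] at h1
    exact (mul_eq_zero.1 h1).resolve_right (hlast j)
  have h1 := hli.fintype_card_le_finrank
  have := card_compl_range hinj
  rw [Nat.card_eq_fintype_card] at this
  omega

end RelationLattice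

/-! ### Coordinate rings of monomial images -/

section MonomialImage

variable {K : Type*} [Field K] {n k : ℕ}

theorem isIrreducible_closure_image {X : Set (Torus K n)} (hX : IsIrreducible X)
    (B : Fin k → Fin n → ℤ) : IsIrreducible (closure (monoMap B '' X)) :=
  (hX.image _ (continuous_monoMap B).continuousOn).closure

/-- The map on coordinate rings induced by a monomial map. -/
noncomputable def coordMap (X : Set (Torus K n)) (B : Fin k → Fin n → ℤ) :
    Coord (monoMap B '' X) →ₐ[K] Coord X :=
  Ideal.quotientMapₐ _ (pull 1 B) fun P hP x hx => by
    rw [evalAt_pull, one_mul]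
    exact hP _ (Set.mem_image_of_mem _ hx)

theorem coordMap_mk (X : Set (Torus K n)) (B : Fin k → Fin n → ℤ) (P : Laurent K k) :
    coordMap X B (Ideal.Quotient.mk _ P) = Ideal.Quotient.mk _ (pull 1 B P) := rfl

theorem coordMap_injective (X : Set (Torus K n)) (B : Fin k → Fin n → ℤ) :
    Function.Injective (coordMap X B) := by
  rw [injective_iff_map_eq_zero]
  intro f hf
  obtain ⟨P, rfl⟩ := Ideal.Quotient.mk_surjective f
  rw [coordMap_mk, Ideal.Quotient.eq_zero_iff_mem] at hf
  rw [Ideal.Quotient.eq_zero_iff_mem]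
  rintro _ ⟨x, hx, rfl⟩
  have := hf x hx
  rwa [evalAt_pull, one_mul] at this

theorem tr_image_le (X : Set (Torus K n)) (B : Fin k → Fin n → ℤ) :
    tr (monoMap B '' X) ≤ tr X := by
  have := trdeg_le_of_injective (coordMap X B) (coordMap_injective X B)
  rw [← coe_tr, ← coe_tr] at this
  exact_mod_cast this

/-- Evaluation of an element of the coordinate ring at a point of `X`. -/
noncomputable def evalCoord {X : Set (Torus K n)} (x : X) : Coord X →ₐ[K] K :=
  Ideal.Quotient.liftₐ _ (evalAt (x : Torus K n)) fun _ ha => ha x x.2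

theorem evalCoord_mk {X : Set (Torus K n)} (x : X) (P : Laurent K n) :
    evalCoord x (Ideal.Quotient.mk _ P) = evalAt (x : Torus K n) P := rfl

end MonomialImage

/-! ### Quotients by one-parameter subgroups -/

section Quotient

variable {K : Type*} [Field K] {n : ℕ}

/-- The matrix of the quotient map by the one-parameter subgroup of direction `a`. -/
def quotMatrix (a : Fin n → ℤ) (i₀ : Fin n) : Fin n → Fin n → ℤ :=
  fun i => a i₀ • Pi.single i 1 - a i • Pi.single i₀ 1

theorem monoMap_quotMatrix (a : Fin n → ℤ) (i₀ i : Fin n) (x : Torus K n) :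
    monoMap (quotMatrix a i₀) x i = x i ^ a i₀ / x i₀ ^ a i := by
  rw [monoMap_apply, quotMatrix, chr_sub, chr_smul, chr_smul, chr_single, chr_single, zpow_one,
    zpow_one]

theorem monoMap_quotMatrix_cochar (a b : Fin n → ℤ) (i₀ : Fin n) (t : Kˣ) :
    monoMap (quotMatrix a i₀) (cochar b t) = cochar (fun i => a i₀ * b i - a i * b i₀) t := by
  ext i
  rw [monoMap_quotMatrix]
  simp only [cochar]
  rw [← zpow_mul, ← zpow_mul, div_eq_mul_inv, ← zpow_sub, mul_comm (b i), mul_comm (b i₀)]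

theorem monoMap_quotMatrix_self (a : Fin n → ℤ) (i₀ : Fin n) (t : Kˣ) :
    monoMap (quotMatrix a i₀) (cochar a t) = 1 := by
  rw [monoMap_quotMatrix_cochar]
  ext i
  simp [cochar, mul_comm]

/-- The coordinate `x i₀` is transcendental over the functions pulled back from the quotient. Along
the orbit of `cochar a t` these are constant while `x i₀` scales by `t ^ a i₀`, so in a polynomial
relation each term vanishes separately. -/
theorem tr_quot_add_one_le [Infinite K] {X : Set (Torus K n)} (hX : IsIrreducible X)
    {a : Fin n → ℤ} {i₀ : Fin n} (ha : a i₀ ≠ 0)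
    (hstab : ∀ t, ∀ x ∈ X, cochar a t * x ∈ X) :
    tr (monoMap (quotMatrix a i₀) '' X) + 1 ≤ tr X := by
  classical
  set B := quotMatrix a i₀
  have := vanIdeal_isPrime hX
  have hX' : IsIrreducible (monoMap B '' X) := hX.image _ (continuous_monoMap B).continuousOn
  have := vanIdeal_isPrime hX'
  let _ : Algebra (Coord (monoMap B '' X)) (Coord X) := (coordMap X B).toRingHom.toAlgebra
  have hmap : ∀ f, algebraMap (Coord (monoMap B '' X)) (Coord X) f = coordMap X B f := fun _ => rfl
  have : IsScalarTower K (Coord (monoMap B '' X)) (Coord X) :=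
    IsScalarTower.of_algebraMap_eq fun c => ((coordMap X B).commutes c).symm
  have : FaithfulSMul (Coord (monoMap B '' X)) (Coord X) :=
    (faithfulSMul_iff_algebraMap_injective _ _).2 (coordMap_injective X B)
  have htrans : Transcendental (Coord (monoMap B '' X)) (mon X (Pi.single i₀ 1)) := by
    rw [transcendental_iff]
    intro p hp
    choose c hc using fun k => Ideal.Quotient.mk_surjective (p.coeff k)
    have hsum : ∀ x ∈ X, ∑ k ∈ p.support, evalAt (monoMap B x) (c k) * (x i₀ : K) ^ k = 0 := by
      intro x hx
      have h1 := congrArg (evalCoord (⟨x, hx⟩ : X)) hp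
      rw [Polynomial.aeval_def, Polynomial.eval₂_eq_sum, Polynomial.sum, map_sum, map_zero] at h1
      rw [← h1]
      refine Finset.sum_congr rfl fun k _ => ?_
      rw [map_mul, map_pow, hmap, ← hc, coordMap_mk, evalCoord_mk, evalAt_pull, mon, evalCoord_mk,
        evalAt_single_one, chr_single, one_mul, zpow_one]
    ext k
    rw [Polynomial.coeff_zero]
    by_contra hk
    have hk' : k ∈ p.support := Polynomial.mem_support_iff.2 hk
    apply hk
    rw [← hc, Ideal.Quotient.eq_zero_iff_mem]
    rintro _ ⟨x, hx, rfl⟩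
    have hz := coeff_eq_zero_of_forall p.support
      (fun k => evalAt (monoMap B x) (c k) * (x i₀ : K) ^ k) (fun k => a i₀ * k) (fun t => by
        have h1 := hsum _ (hstab t x hx)
        rw [← h1]
        refine Finset.sum_congr rfl fun k _ => ?_
        rw [map_mul, monoMap_quotMatrix_self, one_mul, Pi.mul_apply, cochar, Units.val_mul, mul_pow,
          zpow_mul, zpow_natCast, Units.val_pow_eq_pow_val]
        ring) (a i₀ * k)
    have hfil : p.support.filter (fun j : ℕ => a i₀ * (j : ℤ) = a i₀ * k) = {k} := by
      ext j
      simp only [Finset.mem_filter, Finset.mem_singleton, mul_right_inj' ha, Nat.cast_inj]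
      exact ⟨fun h => h.2, fun h => ⟨h ▸ hk', h⟩⟩
    rw [hfil, Finset.sum_singleton] at hz
    exact (mul_eq_zero.1 hz).resolve_right (pow_ne_zero _ (Units.ne_zero _))
  have : Algebra.Transcendental (Coord (monoMap B '' X)) (Coord X) := ⟨⟨_, htrans⟩⟩
  have hpos := trdeg_pos (Coord (monoMap B '' X)) (Coord X)
  have hadd := trdeg_add_eq K (Coord (monoMap B '' X)) (A := Coord X)
  rw [← coe_tr, ← coe_tr] at hadd
  have h1 : (tr (monoMap B '' X) : Cardinal) + 1 ≤ tr X := by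
    rw [← hadd]
    gcongr
    exact Cardinal.one_le_iff_pos.2 hpos
  exact_mod_cast h1

theorem finrank_comap_le {n k : ℕ} (L : (Fin k → ℤ) →ₗ[ℤ] (Fin n → ℤ))
    (M : Submodule ℤ (Fin n → ℤ)) {r : ℕ} (hr : Module.finrank ℤ (LinearMap.ker L) ≤ r) :
    Module.finrank ℤ (M.comap L) ≤ Module.finrank ℤ M + r := by
  let g : M.comap L →ₗ[ℤ] M := L.restrict fun _ h => h
  have h1 := Submodule.finrank_quotient_add_finrank (LinearMap.ker g)
  have h2 : Module.finrank ℤ (_ ⧸ LinearMap.ker g) ≤ Module.finrank ℤ M :=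
    g.quotKerEquivRange.finrank_eq.trans_le (Submodule.finrank_le _)
  let e : LinearMap.ker g →ₗ[ℤ] LinearMap.ker L :=
    LinearMap.codRestrict _ ((M.comap L).subtype.comp (LinearMap.ker g).subtype) fun x => by
      have := congrArg Subtype.val x.2
      exact this
  have he : Function.Injective e := fun x y h => by
    have h' : ((e x : LinearMap.ker L) : Fin k → ℤ) = e y := by rw [h]
    exact Subtype.ext (Subtype.ext h')
  have h3 := LinearMap.finrank_le_finrank_of_injective he
  omega

theorem finrank_le_one_of_coord {N : Submodule ℤ (Fin n → ℤ)} (i₀ : Fin n)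
    (h : ∀ m ∈ N, m i₀ = 0 → m = 0) : Module.finrank ℤ N ≤ 1 := by
  let e : N →ₗ[ℤ] ℤ := (LinearMap.proj i₀).comp N.subtype
  have he : Function.Injective e := by
    rw [injective_iff_map_eq_zero]
    exact fun x hx => Subtype.ext (h x x.2 hx)
  simpa using LinearMap.finrank_le_finrank_of_injective he

/-- The quotient stays in the same ambient torus with coordinate `i₀` equal to `1`, which accounts
for the one possible extra relation. Since `tr` drops by at least one, the strict inequality for
non-cosets need not be preserved for free: it follows from these two estimates together. -/
theorem finrank_relLattice_quot_le (X : Set (Torus K n)) {a : Fin n → ℤ} {i₀ : Fin n}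
    (ha : a i₀ ≠ 0) : Module.finrank ℤ (relLattice (monoMap (quotMatrix a i₀) '' X)) ≤
      Module.finrank ℤ (relLattice X) + 1 := by
  classical
  rw [relLattice_image]
  refine finrank_comap_le _ _ (finrank_le_one_of_coord i₀ fun m hm hm0 => ?_)
  ext i
  by_cases hi : i = i₀
  · rw [hi, hm0]; rfl
  have h1 := congrFun (LinearMap.mem_ker.1 hm) i
  rw [expMap_apply, Finset.sum_apply, Finset.sum_eq_single i] at h1
  · simpa [quotMatrix, hi, ha] using h1
  · intro j _ hj
    simp [quotMatrix, hi, hj.symm]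
  · simp

/-- The action of the quotient map on directions. -/
def quotDir (a : Fin n → ℤ) (i₀ : Fin n) : (Fin n → ℤ) →ₗ[ℤ] (Fin n → ℤ) where
  toFun b := fun i => a i₀ * b i - a i * b i₀
  map_add' b c := by ext i; simp; ring
  map_smul' z b := by ext i; simp; ring

theorem finrank_le_finrank_map_quotDir (V : Submodule ℤ (Fin n → ℤ)) {a : Fin n → ℤ} {i₀ : Fin n}
    (ha : a i₀ ≠ 0) :
    Module.finrank ℤ V ≤ Module.finrank ℤ (V.map (quotDir a i₀)) + 1 := by
  have h1 : Module.finrank ℤ V ≤ Module.finrank ℤ ((V.map (quotDir a i₀)).comap (quotDir a i₀)) :=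
    Submodule.finrank_mono (Submodule.le_comap_map _ _)
  refine h1.trans (finrank_comap_le _ _ (finrank_le_one_of_coord i₀ fun m hm hm0 => ?_))
  ext i
  have h2 := congrFun (LinearMap.mem_ker.1 hm) i
  change a i₀ * m i - a i * m i₀ = 0 at h2
  rw [hm0, mul_zero, sub_zero] at h2
  exact (mul_eq_zero.1 h2).resolve_left ha

end Quotient

/-! ### Lifting torsion counts from a quotient -/

section QuotientCount

variable {K : Type*} [Field K] {n : ℕ}

/-- Given `y` and `x i₀`, every `x i ^ a i₀` is determined, so two points differ by roots of unity
of order dividing `a i₀`. -/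
theorem ncard_quot_fiber_le (a : Fin n → ℤ) {i₀ : Fin n} (ha : a i₀ ≠ 0) (y : Torus K n) (u : Kˣ) :
    {x : Torus K n | monoMap (quotMatrix a i₀) x = y ∧ x i₀ = u}.Finite ∧
      {x : Torus K n | monoMap (quotMatrix a i₀) x = y ∧ x i₀ = u}.ncard ≤ (a i₀).natAbs ^ n := by
  set A := {x : Torus K n | monoMap (quotMatrix a i₀) x = y ∧ x i₀ = u}
  rcases A.eq_empty_or_nonempty with h | ⟨x₀, hx₀⟩
  · rw [h]; simp
  have hroots := finite_pow_eq_one (K := K) n (Int.natAbs_pos.2 ha)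
  have hmaps : Set.MapsTo (fun x => x / x₀) A {x : Torus K n | x ^ (a i₀).natAbs = 1} := by
    intro x hx
    have h1 : ∀ i, (x i / x₀ i) ^ a i₀ = 1 := by
      intro i
      have h2 := congrFun (hx.1.trans hx₀.1.symm) i
      rw [monoMap_quotMatrix, monoMap_quotMatrix, hx.2, hx₀.2, div_left_inj] at h2
      rw [div_zpow, h2, div_self']
    have h3 : ∀ i, (x i / x₀ i) ^ (a i₀).natAbs = 1 := by
      intro i
      rcases Int.natAbs_eq (a i₀) with h | h
      · rw [← zpow_natCast, ← h]; exact h1 i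
      · rw [← zpow_natCast, ← neg_eq_iff_eq_neg.2 h, zpow_neg, h1 i, inv_one]
    ext i
    exact congrArg Units.val (h3 i)
  have hinj : Set.InjOn (fun x => x / x₀) A := fun x _ x' _ h => div_left_injective h
  exact ⟨Set.Finite.of_injOn hmaps hinj hroots.1,
    (Set.ncard_le_ncard_of_injOn _ hmaps hinj hroots.1).trans hroots.2⟩

/-- Sort points by `k`, the order of `x` divided by the order of its image. The image has order at
most `T / k`, which leaves `O((T / k) ^ e)` images. Over each one, `x i₀` is a root of unity of a
fixed order bound, with at most `T` values, and then `x` has boundedly many. The sum over `k`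
converges because `e > 1`. -/
theorem TorsionBound.of_quot {X : Set (Torus K n)} {a : Fin n → ℤ} {i₀ : Fin n} (ha : a i₀ ≠ 0)
    {e : ℝ} (he : 1 < e) (h : TorsionBound (monoMap (quotMatrix a i₀) '' X) e) :
    TorsionBound X (e + 1) := by
  classical
  set q := monoMap (K := K) (quotMatrix a i₀)
  obtain ⟨C, hC0, hC⟩ := h.exists_nonneg
  have hsum : Summable fun k : ℕ => 1 / (k : ℝ) ^ e := Real.summable_one_div_nat_rpow.2 he
  set S := ∑' k : ℕ, 1 / (k : ℝ) ^ e
  refine ⟨((a i₀).natAbs : ℝ) ^ n * C * S, fun T hT => ?_⟩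
  have hT0 : 0 < T := by linarith
  let A : ℕ → Set (Torus K n) := fun k => {x ∈ torsionUpTo X T | orderOf x = k * orderOf (q x)}
  have hAfin : ∀ k, (A k).Finite := fun k => (finite_torsionUpTo X T).subset fun x hx => hx.1
  have hcover : torsionUpTo X T ⊆ ⋃ k ∈ Finset.Icc 1 ⌊T⌋₊, A k := by
    intro x hx
    obtain ⟨k, hk⟩ := orderOf_map_dvd q x
    have hpos := hx.2.1.orderOf_pos
    have hk0 : k ≠ 0 := by rintro rfl; simp [hk] at hpos
    have hq0 : 0 < orderOf (q x) := (q.isOfFinOrder hx.2.1).orderOf_pos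
    simp only [Set.mem_iUnion]
    refine ⟨k, Finset.mem_Icc.2 ⟨Nat.one_le_iff_ne_zero.2 hk0, Nat.le_floor (le_trans ?_ hx.2.2)⟩,
      hx, by rw [hk, mul_comm]⟩
    rw [hk]
    exact_mod_cast Nat.le_mul_of_pos_left k hq0
  have hA : ∀ k ∈ Finset.Icc 1 ⌊T⌋₊,
      ((A k).ncard : ℝ) ≤ ((a i₀).natAbs : ℝ) ^ n * C * T ^ (e + 1) * (1 / (k : ℝ) ^ e) := by
    intro k hk
    obtain ⟨hk1, hk2⟩ := Finset.mem_Icc.1 hk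
    have hkR : (0 : ℝ) < k := by exact_mod_cast hk1
    have hkT : (k : ℝ) ≤ T := (Nat.le_floor_iff hT0.le).1 hk2
    have hTk : 1 ≤ T / k := by rwa [one_le_div hkR]
    have h1 : (A k).ncard ≤ ((a i₀).natAbs ^ n * ⌊T⌋₊) * (torsionUpTo (q '' X) (T / k)).ncard := by
      refine ncard_le_mul_ncard_of_fiber q (finite_torsionUpTo _ _) ?_ (hAfin k) ?_
      · intro x hx
        refine ⟨Set.mem_image_of_mem _ hx.1.1, q.isOfFinOrder hx.1.2.1, ?_⟩
        rw [le_div_iff₀ hkR]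
        have h2 := hx.1.2.2
        rw [hx.2] at h2
        push_cast at h2
        linarith
      · intro y hy
        have hN : 0 < k * orderOf y := Nat.mul_pos hk1 hy.2.1.orderOf_pos
        have hNT : k * orderOf y ≤ ⌊T⌋₊ := by
          refine Nat.le_floor ?_
          have h2 := hy.2.2
          rw [le_div_iff₀ hkR] at h2
          push_cast
          linarith
        have hroots := finite_pow_eq_one (K := K) 1 hN
        refine (ncard_le_mul_ncard_of_fiber (fun x : Torus K n => (fun _ => x i₀ : Torus K 1))
          (C := (a i₀).natAbs ^ n) hroots.1 ?_ ((hAfin k).subset fun x hx => hx.1) ?_).trans ?_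
        · rintro x ⟨hx, rfl⟩
          have h2 := congrFun (pow_orderOf_eq_one x) i₀
          rw [hx.2] at h2
          funext _
          exact h2
        · intro u _
          refine (Set.ncard_le_ncard ?_ (ncard_quot_fiber_le a ha y (u 0)).1).trans
            (ncard_quot_fiber_le a ha y (u 0)).2
          rintro x ⟨⟨-, hx⟩, hxu⟩
          exact ⟨hx, congrFun hxu 0⟩
        · refine Nat.mul_le_mul_left _ (hroots.2.trans ?_)
          rwa [pow_one]
    calc ((A k).ncard : ℝ)
        ≤ (((a i₀).natAbs : ℝ) ^ n * ⌊T⌋₊) * (torsionUpTo (q '' X) (T / k)).ncard := by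
          exact_mod_cast h1
      _ ≤ (((a i₀).natAbs : ℝ) ^ n * T) * (C * (T / k) ^ e) := by
          gcongr
          · exact Nat.floor_le hT0.le
          · exact hC _ hTk
      _ = ((a i₀).natAbs : ℝ) ^ n * C * T ^ (e + 1) * (1 / (k : ℝ) ^ e) := by
          rw [Real.div_rpow hT0.le hkR.le, Real.rpow_add hT0, Real.rpow_one]
          ring
  calc ((torsionUpTo X T).ncard : ℝ) ≤ ((⋃ k ∈ Finset.Icc 1 ⌊T⌋₊, A k).ncard : ℝ) := by
        exact_mod_cast Set.ncard_le_ncard hcover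
          (Set.Finite.biUnion (Finset.finite_toSet _) fun k _ => hAfin k)
    _ ≤ ∑ k ∈ Finset.Icc 1 ⌊T⌋₊, ((A k).ncard : ℝ) := by
        exact_mod_cast Finset.set_ncard_biUnion_le _ _
    _ ≤ ∑ k ∈ Finset.Icc 1 ⌊T⌋₊,
          ((a i₀).natAbs : ℝ) ^ n * C * T ^ (e + 1) * (1 / (k : ℝ) ^ e) := Finset.sum_le_sum hA
    _ ≤ ((a i₀).natAbs : ℝ) ^ n * C * T ^ (e + 1) * S := by
        rw [← Finset.mul_sum]
        gcongr
        exact hsum.sum_le_tsum _ fun _ _ => by positivity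
    _ = ((a i₀).natAbs : ℝ) ^ n * C * S * T ^ (e + 1) := by ring

/-- Writing the orbit map as a translated monomial map from the torus of dimension one makes its
continuity available. -/
theorem mul_cochar_eq (x : Torus K n) (a : Fin n → ℤ) (t : Kˣ) :
    x * cochar a t = x * monoMap (fun i (_ : Fin 1) => a i) (fun _ => t) := by
  congr 1
  ext i
  simp [cochar, monoMap_apply, chr]

theorem tr_le {X : Set (Torus K n)} (hX : IsIrreducible X) : tr X ≤ n :=
  (Nat.le_add_right _ _).trans (tr_add_finrank_le hX)

end QuotientCount

/-! ### Irreducibility of tori and of unions of translates -/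

section Irreducibility

variable {K : Type*} [Field K] [Infinite K] {n : ℕ}

theorem eq_of_forall_chr_eq {m m' : Fin n → ℤ} (h : ∀ x : Torus K n, chr x m = chr x m') :
    m = m' := by
  classical
  ext i
  by_contra hi
  have hx : ∀ (t : Kˣ) (v : Fin n → ℤ), chr (Function.update 1 i t) v = t ^ v i := by
    intro t v
    rw [chr, Finset.prod_eq_single i]
    · simp
    · intro j _ hj; simp [hj]
    · simp
  have := coeff_eq_zero_of_forall (K := K) (Finset.univ : Finset Bool)
    (fun b => if b then 1 else -1) (fun b => if b then m i else m' i) (fun t => by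
      have h1 := h (Function.update 1 i t)
      rw [hx, hx] at h1
      simp [h1]) (m i)
  rw [Finset.sum_filter] at this
  simp [Ne.symm hi] at this

/-- The character `x ↦ x^m` as a homomorphism to the multiplicative monoid of the field. -/
def chrHom (K : Type*) [Field K] {n : ℕ} (m : Fin n → ℤ) : Torus K n →* K where
  toFun x := (chr x m : K)
  map_one' := by simp
  map_mul' x y := by simp [chr_mul]

/-- Over an infinite field distinct exponents give distinct characters, and distinct characters are
linearly independent. -/
theorem vanIdeal_univ : vanIdeal (Set.univ : Set (Torus K n)) = ⊥ := by
  rw [eq_bot_iff]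
  intro P hP
  have hli : LinearIndependent K fun m : Fin n → ℤ => (chrHom K m : Torus K n → K) := by
    refine (linearIndependent_monoidHom (Torus K n) K).comp (chrHom K) fun m m' h => ?_
    exact eq_of_forall_chr_eq (K := K) fun x => Units.ext (DFunLike.congr_fun h x)
  have h0 := linearIndependent_iff.1 hli P.coeff (by
    ext x
    rw [Finsupp.linearCombination_apply, Finsupp.sum, Finset.sum_apply]
    have := hP x trivial
    rw [evalAt_eq_sum] at this
    exact this)
  rw [Ideal.mem_bot]
  exact AddMonoidAlgebra.coeff_injective h0

theorem isIrreducible_univ_torus : IsIrreducible (Set.univ : Set (Torus K n)) := by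
  apply isIrreducible_of_isPrime
  rw [vanIdeal_univ]
  exact Ideal.isPrime_bot

/-- The union of the translates of an irreducible set by a one-parameter subgroup is irreducible. -/
theorem isIrreducible_mul_cochar {Y : Set (Torus K n)} (hY : IsIrreducible Y) (a : Fin n → ℤ) :
    IsIrreducible {z : Torus K n | ∃ y ∈ Y, ∃ t : Kˣ, z = y * cochar a t} := by
  refine ⟨?_, ?_⟩
  · obtain ⟨y, hy⟩ := hY.1
    exact ⟨y * cochar a 1, y, hy, 1, rfl⟩
  · rintro U V hU hV ⟨_, ⟨y, hy, t, rfl⟩, hyU⟩ ⟨_, ⟨y', hy', t', rfl⟩, hyV⟩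
    -- Irreducibility of `Y` gives one point `w` that works with both parameters; irreducibility of
    -- the torus of dimension one then gives one parameter that works for both open sets.
    obtain ⟨w, hwY, hwU, hwV⟩ := hY.2 _ _ (hU.preimage (continuous_mul_right_torus (cochar a t)))
      (hV.preimage (continuous_mul_right_torus (cochar a t'))) ⟨y, hy, hyU⟩ ⟨y', hy', hyV⟩
    have hc := continuous_mul_monoMap w (fun i (_ : Fin 1) => a i)
    obtain ⟨τ, -, hτU, hτV⟩ := (isIrreducible_univ_torus (K := K) (n := 1)).2 _ _
      (hU.preimage hc) (hV.preimage hc)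
      ⟨fun _ => t, trivial, by rw [Set.mem_preimage, ← mul_cochar_eq]; exact hwU⟩
      ⟨fun _ => t', trivial, by rw [Set.mem_preimage, ← mul_cochar_eq]; exact hwV⟩
    have hτ : τ = fun _ => τ 0 := by
      funext j; rw [Subsingleton.elim j 0]
    rw [Set.mem_preimage, hτ, ← mul_cochar_eq] at hτU hτV
    exact ⟨_, ⟨w, hwY, τ 0, rfl⟩, hτU, hτV⟩

theorem tr_lt_of_mem_vanIdeal {X : Set (Torus K n)} (hX : IsClosed X) (hirr : IsIrreducible X)
    {P : Laurent K n} (hP : P ≠ 0) (hPX : P ∈ vanIdeal X) : tr X < n := by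
  by_contra! h
  have h1 : X = Set.univ := eq_of_subset_of_tr_le isClosed_univ isIrreducible_univ_torus hX hirr
    (Set.subset_univ _) ((tr_le isIrreducible_univ_torus).trans h)
  rw [h1, vanIdeal_univ] at hPX
  exact hP hPX

/-- If a nonzero `P` vanishes on all translates of a hypersurface by a one-parameter subgroup, the
hypersurface is stable under this subgroup. -/
theorem cochar_mul_mem_of_vanishing {s : ℕ} {Y : Set (Torus K (s + 1))} (hY : IsClosed Y)
    (hirr : IsIrreducible Y) (hs : s ≤ tr Y) {P : Laurent K (s + 1)} (hP : P ≠ 0)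
    {a : Fin (s + 1) → ℤ} (hPY : ∀ y ∈ Y, ∀ t, evalAt (y * cochar a t) P = 0) (t : Kˣ)
    {y : Torus K (s + 1)} (hy : y ∈ Y) : cochar a t * y ∈ Y := by
  have hW := isIrreducible_mul_cochar hirr a
  set W := {z : Torus K (s + 1) | ∃ y ∈ Y, ∃ t : Kˣ, z = y * cochar a t}
  have hPW : P ∈ vanIdeal (closure W) := by
    rw [vanIdeal_closure]
    rintro _ ⟨y, hy, t, rfl⟩
    exact hPY y hy t
  -- `closure W` is a proper irreducible closed set containing the hypersurface `Y`, so the two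
  -- coincide by dimension.
  have htr := tr_lt_of_mem_vanIdeal isClosed_closure hW.closure hP hPW
  have hYW : Y ⊆ closure W := fun y hy =>
    subset_closure ⟨y, hy, 1, by rw [cochar_one, mul_one]⟩
  have := eq_of_subset_of_tr_le isClosed_closure hW.closure hY hirr hYW (by omega)
  rw [this]
  exact subset_closure ⟨y, hy, t, mul_comm _ _⟩

/-- A set whose transcendence degree is smaller than the ambient dimension satisfies a nontrivial
equation. -/
theorem exists_ne_zero_mem_vanIdeal {X : Set (Torus K n)} (h : tr X < n) :
    ∃ P : Laurent K n, P ≠ 0 ∧ P ∈ vanIdeal X := by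
  by_contra! hcon
  have hind : AlgebraicIndependent K fun j : Fin n => mon X (Pi.single j 1) := by
    rw [algebraicIndependent_iff]
    intro p hp
    rw [← mk_substMon, Ideal.Quotient.eq_zero_iff_mem] at hp
    by_contra hp0
    -- The product of the variables forces the point of nonvanishing to lie in the torus.
    have hprod : p * ∏ i, MvPolynomial.X i ≠ 0 :=
      mul_ne_zero hp0 (Finset.prod_ne_zero_iff.2 fun i _ => MvPolynomial.X_ne_zero i)
    obtain ⟨x, hx⟩ : ∃ x, MvPolynomial.eval x (p * ∏ i, MvPolynomial.X i) ≠ 0 := by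
      by_contra! h0
      exact hprod (MvPolynomial.funext fun x => by rw [h0 x, map_zero])
    rw [map_mul, map_prod, mul_ne_zero_iff, Finset.prod_ne_zero_iff] at hx
    simp only [MvPolynomial.eval_X] at hx
    have hP : substMon (fun j => Pi.single j 1) p ≠ 0 := by
      intro h0
      have h1 := evalAt_substMon (fun j => Pi.single j 1) (fun i => Units.mk0 (x i) (hx.2 i (Finset.mem_univ i))) p
      rw [h0, map_zero] at h1
      simp only [chr_single, zpow_one, Units.val_mk0] at h1
      exact hx.1 h1.symm
    exact hcon _ hP hp
  have h1 := hind.lift_cardinalMk_le_trdeg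
  rw [← coe_tr] at h1
  simp at h1
  omega

end Irreducibility

/-! ### Constant monomials and closed conditions on translates -/

section General

variable {K : Type*} [Field K] {n : ℕ}

theorem mon_eq_algebraMap {X : Set (Torus K n)} {m : Fin n → ℤ} {c : Kˣ}
    (h : ∀ x ∈ X, chr x m = c) : mon X m = algebraMap K (Coord X) c := by
  have h1 : AddMonoidAlgebra.single m 1 - algebraMap K (Laurent K n) c ∈ vanIdeal X := by
    intro x hx
    rw [map_sub, evalAt_single_one, AlgHom.commutes, h x hx]
    exact sub_self _
  have h2 := Ideal.Quotient.eq_zero_iff_mem.2 h1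
  rw [map_sub, sub_eq_zero] at h2
  exact h2

theorem isClosed_vanishing_translates (P : Laurent K n) (a : Fin n → ℤ) :
    IsClosed {y : Torus K n | ∀ t, evalAt (y * cochar a t) P = 0} := by
  rw [Set.ofPred_forall]
  exact isClosed_iInter fun t =>
    (isClosed_setOf_evalAt P).preimage (continuous_mul_right_torus (cochar a t))

end General

/-! ### Characterization of torsion cosets -/

section Cosets

variable {K : Type*} [Field K] [IsAlgClosed K] {n : ℕ}

/-- The coordinate ring is a domain, so an element integral over the algebraically closed field `K`
is a constant. -/
theorem mem_relLattice_of_isIntegral {X : Set (Torus K n)} (hX : IsIrreducible X) {m : Fin n → ℤ}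
    (h : IsIntegral K (mon X m)) : m ∈ relLattice X := by
  have := vanIdeal_isPrime hX
  obtain ⟨c, hc⟩ := (IsAlgClosed.algebraMap_bijective_of_isIntegral (k := K)
    (K := integralClosure K (Coord X))).2 ⟨mon X m, h⟩
  have hc' : algebraMap K (Coord X) c = mon X m := congrArg Subtype.val hc
  have hval : ∀ x ∈ X, (chr x m : K) = c := by
    intro x hx
    have h1 := congrArg (evalCoord (⟨x, hx⟩ : X)) hc'
    rw [AlgHom.commutes, mon, evalCoord_mk, evalAt_single_one] at h1
    exact h1.symm
  obtain ⟨x₀, hx₀⟩ := hX.1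
  exact ⟨chr x₀ m, fun x hx => Units.ext ((hval x hx).trans (hval x₀ hx₀).symm)⟩

/-- A root of a constant is integral over `K`. Saturation makes the quotient of `ℤⁿ` by the lattice
free, so that the subgroup it defines is irreducible. -/
theorem relLattice_saturated {X : Set (Torus K n)} (hX : IsIrreducible X) {m : Fin n → ℤ} {k : ℤ}
    (hk : k ≠ 0) (h : k • m ∈ relLattice X) : m ∈ relLattice X := by
  have hk' : k.natAbs • m ∈ relLattice X := by
    rw [← natCast_zsmul]
    rcases abs_choice k with h' | h' <;> rw [Int.abs_eq_natAbs] at h' <;> rw [h']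
    · exact h
    · rw [neg_smul]; exact Submodule.neg_mem _ h
  obtain ⟨c, hc⟩ := hk'
  have h1 := mon_eq_algebraMap hc
  rw [mon_nsmul] at h1
  refine mem_relLattice_of_isIntegral hX (IsIntegral.of_pow (Int.natAbs_pos.2 hk) ?_)
  rw [h1]
  exact isIntegral_algebraMap

/-- If `tr X = 0`, every monomial is algebraic, hence constant, and the relation lattice has rank
`n`. The bound keeps exponents above `1`, as `TorsionBound.of_quot` requires. -/
theorem one_le_tr {X : Set (Torus K n)} (hX : IsIrreducible X)
    (hnc : tr X + Module.finrank ℤ (relLattice X) < n) : 1 ≤ tr X := by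
  by_contra! h0
  have h0' : tr X = 0 := by omega
  have := vanIdeal_isPrime hX
  have h1 : Algebra.trdeg K (Coord X) = 0 := by rw [← coe_tr, h0', Nat.cast_zero]
  have halg := trdeg_eq_zero_iff.1 h1
  have htop : relLattice X = ⊤ := by
    rw [eq_top_iff]
    intro m _
    exact mem_relLattice_of_isIntegral hX (halg.isAlgebraic _).isIntegral
  rw [htop, finrank_top] at hnc
  simp at hnc

/-- A set of maximal dimension among those with its multiplicative relations which contains a
torsion point is a torsion coset. -/
theorem isTorsionCoset_of_le {X : Set (Torus K n)} (hX : IsClosed X) (hirr : IsIrreducible X)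
    (hle : n ≤ tr X + Module.finrank ℤ (relLattice X)) {ζ : Torus K n} (hζX : ζ ∈ X)
    (hζ : IsOfFinOrder ζ) : IsTorsionCoset X := by
  classical
  set M := relLattice X with hM
  let Q := (Fin n → ℤ) ⧸ M
  have htf : Module.IsTorsionFree ℤ Q := by
    refine .of_smul_eq_zero fun k q hkq => ?_
    obtain ⟨m, rfl⟩ := M.mkQ_surjective q
    rw [or_iff_not_imp_left]
    intro hk
    rw [← map_smul] at hkq
    exact (Submodule.Quotient.mk_eq_zero M).2
      (relLattice_saturated hirr hk ((Submodule.Quotient.mk_eq_zero M).1 hkq))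
  let b := Module.finBasis ℤ Q
  set r := Module.finrank ℤ Q
  -- A basis of the free quotient `ℤⁿ / M` parametrizes the common kernel `G` of the characters in
  -- `M` by a torus, whence `G` is irreducible.
  let B : Fin n → Fin r → ℤ := fun j i => b.repr (M.mkQ (Pi.single j 1)) i
  have hB : ∀ m : Fin n → ℤ, ∑ j, m j • B j = b.repr (M.mkQ m) := by
    intro m
    conv_rhs => rw [← Finset.univ_sum_single m]
    ext i
    simp only [map_sum, Finset.sum_apply, Finsupp.coe_finsetSum, Pi.smul_apply, B]
    refine Finset.sum_congr rfl fun j _ => ?_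
    have : (Pi.single j (m j) : Fin n → ℤ) = m j • Pi.single j 1 := by
      rw [← Pi.single_smul]; simp
    rw [this, map_smul, map_smul]
    rfl
  let G : Subgroup (Torus K n) := (monoMap (K := K) B).range
  have hG : ∀ x, x ∈ G ↔ ∀ m ∈ M, chr x m = 1 := by
    intro x
    constructor
    · rintro ⟨t, rfl⟩ m hm
      have h0 : M.mkQ m = 0 := (Submodule.Quotient.mk_eq_zero M).2 hm
      rw [chr_monoMap, hB, h0, map_zero]
      exact chr_zero t
    · intro hx
      choose v hv using fun i => M.mkQ_surjective (b i)
      refine ⟨fun i => chr x (v i), ?_⟩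
      funext j
      have hmem : (Pi.single j 1 : Fin n → ℤ) - ∑ i, B j i • v i ∈ M := by
        rw [← Submodule.Quotient.mk_eq_zero, ← Submodule.mkQ_apply, map_sub, map_sum, sub_eq_zero]
        conv_lhs => rw [← b.sum_repr (M.mkQ (Pi.single j 1))]
        refine Finset.sum_congr rfl fun i _ => ?_
        rw [map_smul, hv]
      have h1 := hx _ hmem
      rw [chr_sub, div_eq_one, chr_single, zpow_one, chr_sum] at h1
      rw [h1, monoMap_apply, chr]
      exact Finset.prod_congr rfl fun i _ => (chr_smul _ _ _).symm
  have hGset : (G : Set (Torus K n)) = ⋂ m ∈ M, {x | chr x m = 1} := by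
    ext x
    simp only [SetLike.mem_coe, hG, Set.mem_iInter, Set.mem_ofPred_eq]
  have hGclosed : IsClosed (G : Set (Torus K n)) := by
    rw [hGset]
    exact isClosed_biInter fun m _ => isClosed_chr_eq m 1
  have hGirr : IsIrreducible (G : Set (Torus K n)) := by
    have := (isIrreducible_univ_torus (K := K) (n := r)).image (monoMap B)
      (continuous_monoMap B).continuousOn
    rwa [Set.image_univ] at this
  refine ⟨ζ, G, hζ, ⟨isAlgebraicSet_of_isClosed hGclosed, hGirr⟩, ?_⟩
  have hirr' : IsIrreducible ((fun g => ζ * g) '' (G : Set (Torus K n))) :=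
    hGirr.image _ (continuous_mul_left_torus ζ).continuousOn
  -- `X` lies in `ζ * G` because each character in `M` is constant on `X`. Conversely, `M` consists
  -- of relations of `ζ * G`, so its `tr` is at most `n` minus the rank of `M`, hence at most `tr
  -- X`.
  refine eq_of_subset_of_tr_le ((translate ζ).isClosedMap _ hGclosed) hirr' hX hirr ?_ ?_
  · intro x hx
    refine ⟨ζ⁻¹ * x, (hG _).2 fun m hm => ?_, mul_inv_cancel_left ζ x⟩
    obtain ⟨c, hc⟩ := hm
    have h1 : chr (ζ * (ζ⁻¹ * x)) m = chr ζ m := by rw [mul_inv_cancel_left, hc x hx, hc ζ hζX]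
    rw [chr_mul] at h1
    exact mul_eq_left.1 h1
  · have h1 := tr_add_finrank_le hirr'
    have h2 : M ≤ relLattice ((fun g => ζ * g) '' (G : Set (Torus K n))) := by
      intro m hm
      refine ⟨chr ζ m, ?_⟩
      rintro _ ⟨g, hg, rfl⟩
      change chr (ζ * g) m = _
      rw [chr_mul, (hG g).1 hg m hm, mul_one]
    have h3 := Submodule.finrank_mono h2
    omega

end Cosets

/-! ### The power saving -/

section PowerSaving

variable {K : Type*} [Field K] [IsAlgClosed K] {n : ℕ}

/-- Power saving for sets that are not cosets. -/
theorem torsionBound_of_not_coset {X : Set (Torus K n)} (hX : IsClosed X) (hirr : IsIrreducible X)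
    (hnc : tr X + Module.finrank ℤ (relLattice X) < n) :
    TorsionBound X (tr X + 1 - 1 / ((tr X : ℝ) + 1)) := by
  have hinf : Infinite K := IsAlgClosed.instInfinite
  -- The ambient dimension must vary: the inductive step is applied in the torus of dimension `tr X
  -- + 1`.
  induction hs : tr X using Nat.strong_induction_on generalizing n X with
  | _ s ih =>
  subst hs
  obtain ⟨σ, hinj, hσ⟩ := exists_coords_isTranscendenceBasis hirr
  obtain ⟨j, hj⟩ := exists_snoc_independent hinj hσ.1 hnc
  let B : Fin (tr X + 1) → Fin n → ℤ := fun i => Pi.single (Fin.snoc (α := fun _ => Fin n) σ j i) 1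
  have hBσ : ∀ (x : Torus K n) (i : Fin (tr X)), monoMap B x i.castSucc = x (σ i) := by
    intro x i; simp [monoMap_apply, B]
  set Y := closure (monoMap B '' X) with hYdef
  have hYc : IsClosed Y := isClosed_closure
  have hYi : IsIrreducible Y := isIrreducible_closure_image hirr B
  have hYrel : relLattice Y = ⊥ := by
    rw [hYdef, relLattice_closure, relLattice_image, eq_bot_iff]
    intro c hc
    exact hj c hc
  have hYle : tr Y ≤ tr X := by rw [hYdef, tr_closure]; exact tr_image_le X B
  have hYge : tr X ≤ tr Y := by
    have hind : AlgebraicIndependent K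
        fun i : Fin (tr X) => mon Y (Pi.single i.castSucc (1 : ℤ)) := by
      rw [algebraicIndependent_iff]
      intro p hp
      rw [aeval_mon_eq_zero_iff] at hp
      refine (map_eq_zero_iff _ hσ.1).1 ((aeval_mon_eq_zero_iff X _ p).2 fun x hx => ?_)
      have := hp _ (subset_closure (Set.mem_image_of_mem _ hx))
      simpa [hBσ] using this
    have h1 := hind.lift_cardinalMk_le_trdeg
    rw [← coe_tr] at h1
    simpa using h1
  have he0 : (tr X : ℝ) ≤ tr X + 1 - 1 / ((tr X : ℝ) + 1) := by
    have : 1 / ((tr X : ℝ) + 1) ≤ 1 := by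
      rw [div_le_one (by positivity)]; linarith [Nat.cast_nonneg (α := ℝ) (tr X)]
    linarith
  have hYbound : TorsionBound Y (tr X + 1 - 1 / ((tr X : ℝ) + 1)) := by
    obtain ⟨P, hP0, hPY⟩ := exists_ne_zero_mem_vanIdeal (X := Y) (by omega)
    obtain ⟨𝒜, hDfin, hDne, hD⟩ := exists_finite_directions P
    have hiso := torsionBound_isolated (Nat.succ_pos (tr X)) P
    have hbad : ∀ a ∈ 𝒜, TorsionBound (Y ∩ {y | ∀ t, evalAt (y * cochar a t) P = 0})
        (tr X + 1 - 1 / ((tr X : ℝ) + 1)) := by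
      intro a ha
      by_cases hYa : Y ∩ {y | ∀ t, evalAt (y * cochar a t) P = 0} = Y
      -- Here `Y` is a union of one-parameter orbits, so induction applies to its quotient.
      · have hstab : ∀ t, ∀ y ∈ Y, cochar a t * y ∈ Y := fun t y hy =>
          cochar_mul_mem_of_vanishing hYc hYi hYge hP0
            (fun y hy => (Set.inter_eq_left.1 hYa) hy) t hy
        obtain ⟨i₀, hi₀⟩ := Function.ne_iff.1 (hDne a ha)
        have htr := tr_quot_add_one_le hYi hi₀ hstab
        have hrel := finrank_relLattice_quot_le Y hi₀
        rw [hYrel, finrank_bot] at hrel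
        set Y' := closure (monoMap (quotMatrix a i₀) '' Y) with hY'
        rw [← tr_closure, ← hY'] at htr
        rw [← relLattice_closure, ← hY'] at hrel
        have hYi' : IsIrreducible Y' := isIrreducible_closure_image hYi _
        have hnc' : tr Y' + Module.finrank ℤ (relLattice Y') < tr X + 1 := by omega
        have h1 := one_le_tr hYi' hnc'
        have h2 := ih (tr Y') (by omega) isClosed_closure hYi' hnc' rfl
        have h1R : (1 : ℝ) ≤ tr Y' := by exact_mod_cast h1
        have h3R : (tr Y' : ℝ) + 1 ≤ tr X := by exact_mod_cast htr.trans hYle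
        have h4 : 1 / ((tr Y' : ℝ) + 1) ≤ 1 / 2 := by
          apply one_div_le_one_div_of_le <;> linarith
        have h5 : 1 / ((tr X : ℝ) + 1) ≤ 1 / ((tr Y' : ℝ) + 1) := by
          apply one_div_le_one_div_of_le <;> linarith
        -- As `1 ≤ tr Y'`, the exponent is at least `tr Y' + 1/2 > 1`. Lifting adds one, and `tr Y'
        -- + 1 ≤ tr X` keeps the result within the target.
        have h6 := (h2.mono subset_closure le_rfl).of_quot hi₀ (by linarith)
        exact h6.mono Set.inter_subset_left (by linarith)
      · refine (torsionBound_of_ssubset hYc hYi (hYc.inter (isClosed_vanishing_translates P a))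
          (Set.inter_subset_left.ssubset_of_ne hYa)).mono subset_rfl (le_trans ?_ he0)
        exact_mod_cast hYle
    refine ((hiso.mono subset_rfl (by push_cast; exact le_rfl)).union
      (TorsionBound.biUnion hDfin hbad)).mono (fun y hy => ?_) le_rfl
    by_cases h : ∀ a : Fin (tr X + 1) → ℤ, a ≠ 0 → ∃ t, evalAt (y * cochar a t) P ≠ 0
    · exact Or.inl ⟨hPY y hy, h⟩
    · push Not at h
      obtain ⟨a, ha, hat⟩ := h
      obtain ⟨b, hb, hbt⟩ := hD y a ha hat
      refine Or.inr ?_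
      simp only [Set.mem_iUnion]
      exact ⟨b, hb, hy, hbt⟩
  -- Return from `Y` to `X`: the map to `Y` has bounded fibres off a proper closed subset, to which
  -- the trivial bound applies.
  obtain ⟨h, C, hh0, hC⟩ := exists_bounded_fibers hirr hσ
  set Q : Laurent K n := substMon (fun j => Pi.single (σ j) 1) h
  have hQ : ∀ x : Torus K n, evalAt x Q = MvPolynomial.eval (fun j => ((x ∘ σ) j : K)) h := by
    intro x; simp [Q, evalAt_substMon]
  have hZX : X ∩ {x | evalAt x Q = 0} ⊂ X := by
    refine Set.inter_subset_left.ssubset_of_ne fun h => ?_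
    obtain ⟨x, hx, hx'⟩ := exists_eval_ne_zero hσ.1 hh0
    have : x ∈ X ∩ {x | evalAt x Q = 0} := by rw [h]; exact hx
    exact hx' (by rw [← evalAt_substMon]; exact this.2)
  have h1 := (torsionBound_of_ssubset hX hirr (hX.inter (isClosed_setOf_evalAt Q)) hZX).mono
    subset_rfl he0
  have h2 : TorsionBound (X ∩ {x | evalAt x Q ≠ 0}) (tr X + 1 - 1 / ((tr X : ℝ) + 1)) := by
    refine TorsionBound.of_fiber (monoMap B)
      (fun x hx => subset_closure (Set.mem_image_of_mem _ hx.1))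
      (C := C) (fun y => ?_) hYbound
    by_cases hy : MvPolynomial.eval (fun j : Fin (tr X) => (y j.castSucc : K)) h = 0
    · have : {x ∈ X ∩ {x | evalAt x Q ≠ 0} | monoMap B x = y} = ∅ := by
        ext x
        simp only [Set.mem_ofPred_eq, Set.mem_empty_iff_false, iff_false]
        rintro ⟨⟨hx, hxQ⟩, rfl⟩
        refine hxQ ((hQ x).trans ?_)
        simpa [hBσ] using hy
      rw [this]; simp
    · have hf := hC (fun j => y j.castSucc) hy
      have hsub : {x ∈ X ∩ {x | evalAt x Q ≠ 0} | monoMap B x = y} ⊆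
          {x ∈ X | x ∘ σ = fun j => y j.castSucc} := by
        rintro x ⟨⟨hx, -⟩, rfl⟩
        exact ⟨hx, funext fun i => (hBσ x i).symm⟩
      exact ⟨hf.1.subset hsub, (Set.ncard_le_ncard hsub hf.1).trans hf.2⟩
  refine (h1.union h2).mono (fun x hx => ?_) le_rfl
  by_cases hxQ : evalAt x Q = 0
  · exact Or.inl ⟨hx, hxQ⟩
  · exact Or.inr ⟨hx, hxQ⟩

/-- Power saving for sets that are not cosets, taking into account the rank of the stabilizer. -/
theorem torsionBound_of_stabilizer (δ : ℕ) {X : Set (Torus K n)} (hX : IsClosed X)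
    (hirr : IsIrreducible X) (hnc : tr X + Module.finrank ℤ (relLattice X) < n)
    (V : Submodule ℤ (Fin n → ℤ)) (hV : δ ≤ Module.finrank ℤ V)
    (hstab : ∀ a ∈ V, ∀ t, ∀ x ∈ X, cochar a t * x ∈ X) :
    δ < tr X ∧ TorsionBound X (tr X + 1 - 1 / ((tr X : ℝ) - δ + 1)) := by
  have hinf : Infinite K := IsAlgClosed.instInfinite
  induction δ generalizing X V with
  | zero => exact ⟨one_le_tr hirr hnc, by simpa using torsionBound_of_not_coset hX hirr hnc⟩
  | succ δ ih =>
    obtain ⟨a, haV, ha⟩ : ∃ a ∈ V, a ≠ 0 := by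
      refine Submodule.exists_mem_ne_zero_of_ne_bot fun h => ?_
      rw [h, finrank_bot] at hV
      omega
    obtain ⟨i₀, hi₀⟩ := Function.ne_iff.1 ha
    have htr := tr_quot_add_one_le hirr hi₀ (hstab a haV)
    have hrel := finrank_relLattice_quot_le X hi₀
    have hVr := finrank_le_finrank_map_quotDir V hi₀
    set X' := closure (monoMap (quotMatrix a i₀) '' X) with hX'
    rw [← tr_closure, ← hX'] at htr
    rw [← relLattice_closure, ← hX'] at hrel
    -- In the quotient both the dimension and the rank of the stabilizing lattice drop, the former
    -- by at least one and the guaranteed rank by exactly one, so their difference does not grow.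
    obtain ⟨hlt, hbd⟩ := ih (X := X') isClosed_closure (isIrreducible_closure_image hirr _)
      (by omega) (V.map (quotDir a i₀)) (by omega) (by
        rintro _ ⟨b, hb, rfl⟩ t y hy
        have hcl : IsClosed ((fun y => cochar (quotDir a i₀ b) t * y) ⁻¹' X') :=
          isClosed_closure.preimage (continuous_mul_left_torus _)
        refine closure_minimal ?_ hcl hy
        rintro _ ⟨x, hx, rfl⟩
        refine subset_closure ⟨cochar b t * x, hstab b hb t x hx, ?_⟩
        rw [map_mul, monoMap_quotMatrix_cochar]
        rfl)
    refine ⟨by omega, ?_⟩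
    have h1R : (δ : ℝ) + 1 ≤ tr X' := by exact_mod_cast hlt
    have h3R : (tr X' : ℝ) + 1 ≤ tr X := by exact_mod_cast htr
    have hδ0 : (0 : ℝ) ≤ δ := Nat.cast_nonneg δ
    have h4 : 1 / ((tr X' : ℝ) - δ + 1) ≤ 1 / 2 := by
      apply one_div_le_one_div_of_le <;> linarith
    have h5 : 1 / ((tr X : ℝ) - (δ + 1 : ℕ) + 1) ≤ 1 / ((tr X' : ℝ) - δ + 1) := by
      push_cast
      apply one_div_le_one_div_of_le <;> linarith
    have h6 := (hbd.mono subset_closure le_rfl).of_quot hi₀ (by linarith)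
    exact h6.mono subset_rfl (by linarith)

end PowerSaving

/-! ### The stabilizer and its one-parameter subgroups -/

section Stabilizer

variable {K : Type*} [Field K] {n : ℕ}

/-- A closed submonoid of the torus is defined by the characters that are trivial on it. -/
theorem mem_of_forall_chr_eq_one (S : Submonoid (Torus K n)) (hS : IsClosed (S : Set (Torus K n)))
    {z : Torus K n} (hz : ∀ m : Fin n → ℤ, (∀ g ∈ S, chr g m = 1) → chr z m = 1) : z ∈ S := by
  classical
  rw [← SetLike.mem_coe, ← zeroLocus_vanIdeal hS]
  intro P hP
  let χ : (Fin n → ℤ) → (S →* K) := fun m => (chrHom K m).comp S.subtype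
  have hχ : ∀ m m', χ m = χ m' → chr z m = chr z m' := by
    intro m m' h
    have := hz (m - m') fun g hg => by
      rw [chr_sub, div_eq_one]
      have h' : χ m ⟨g, hg⟩ = χ m' ⟨g, hg⟩ := DFunLike.congr_fun h _
      exact Units.ext h'
    rwa [chr_sub, div_eq_one] at this
  have hmaps : ∀ m ∈ P.coeff.support, χ m ∈ P.coeff.support.image χ := fun m hm =>
    Finset.mem_image_of_mem _ hm
  -- Exponents are grouped by the restriction of their character to `S`. Independence of the
  -- distinct restrictions makes the coefficients of `P` sum to zero within each group, and on each
  -- group the value at `z` is constant.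
  have hcoeff := linearIndependent_iff'.1 (linearIndependent_monoidHom S K)
    (P.coeff.support.image χ) (fun ψ => ∑ m ∈ P.coeff.support with χ m = ψ, P.coeff m) (by
      funext g
      have h1 := hP g g.2
      rw [evalAt_eq_sum, ← Finset.sum_fiberwise_of_maps_to hmaps] at h1
      rw [Finset.sum_apply, Pi.zero_apply, ← h1]
      refine Finset.sum_congr rfl fun ψ _ => ?_
      rw [Pi.smul_apply, smul_eq_mul, Finset.sum_mul]
      refine Finset.sum_congr rfl fun m hm => ?_
      rw [← (Finset.mem_filter.1 hm).2]
      rfl)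
  rw [evalAt_eq_sum, ← Finset.sum_fiberwise_of_maps_to hmaps]
  refine Finset.sum_eq_zero fun ψ hψ => ?_
  obtain ⟨m₀, hm₀, rfl⟩ := Finset.mem_image.1 hψ
  rw [Finset.sum_congr rfl (g := fun m => P.coeff m * (chr z m₀ : K)) fun m hm => by
    rw [hχ m m₀ (Finset.mem_filter.1 hm).2], ← Finset.sum_mul, hcoeff _ hψ, zero_mul]

/-- The stabilizer as a submonoid. -/
def stabMonoid (X : Set (Torus K n)) : Submonoid (Torus K n) where
  carrier := stab X
  one_mem' := fun x hx => by rwa [one_mul]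
  mul_mem' := fun {g h} hg hh x hx => by rw [mul_assoc]; exact hg _ (hh x hx)

theorem isClosed_stab {X : Set (Torus K n)} (hX : IsClosed X) : IsClosed (stab X) := by
  have : stab X = ⋂ x ∈ X, (fun g => g * x) ⁻¹' X := by
    ext g; simp [stab]
  rw [this]
  exact isClosed_biInter fun x _ => hX.preimage (continuous_mul_right_torus x)

/-- The lattice of characters that are trivial on the stabilizer. -/
def stabLattice (X : Set (Torus K n)) : Submodule ℤ (Fin n → ℤ) where
  carrier := {m | ∀ g ∈ stab X, chr g m = 1}
  zero_mem' := fun g _ => chr_zero g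
  add_mem' := fun {m m'} h h' g hg => by rw [chr_add, h g hg, h' g hg, one_mul]
  smul_mem' := fun z m h g hg => by rw [chr_smul, h g hg, one_zpow]

/-- The orthogonal complement of a lattice. -/
def orthLattice (L : Submodule ℤ (Fin n → ℤ)) : Submodule ℤ (Fin n → ℤ) where
  carrier := {a | ∀ m ∈ L, a ⬝ᵥ m = 0}
  zero_mem' := fun m _ => zero_dotProduct m
  add_mem' := fun {a b} ha hb m hm => by rw [add_dotProduct, ha m hm, hb m hm, add_zero]
  smul_mem' := fun z a ha m hm => by rw [smul_dotProduct, ha m hm, smul_zero]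

/-- The orthogonal lattice is the kernel of the pairing map from `ℤⁿ` to the dual of `L`, whose rank
is that of `L`. -/
theorem le_finrank_orthLattice_add (L : Submodule ℤ (Fin n → ℤ)) :
    n ≤ Module.finrank ℤ (orthLattice L) + Module.finrank ℤ L := by
  let φ : (Fin n → ℤ) →ₗ[ℤ] (L →ₗ[ℤ] ℤ) :=
    { toFun := fun a => (dotProductBilin ℤ ℤ a).comp L.subtype
      map_add' := fun a b => by ext m; simp
      map_smul' := fun z a => by ext m; exact smul_dotProduct z a (m : Fin n → ℤ) }
  have hker : LinearMap.ker φ = orthLattice L := by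
    ext a
    rw [LinearMap.mem_ker, LinearMap.ext_iff]
    exact ⟨fun h m hm => h ⟨m, hm⟩, fun h m => h m m.2⟩
  have h1 := Submodule.finrank_quotient_add_finrank (LinearMap.ker φ)
  have h2 : Module.finrank ℤ (_ ⧸ LinearMap.ker φ) ≤ Module.finrank ℤ (L →ₗ[ℤ] ℤ) :=
    φ.quotKerEquivRange.finrank_eq.trans_le (Submodule.finrank_le _)
  rw [Module.finrank_linearMap, Module.finrank_self, mul_one] at h2
  rw [hker] at h1 h2
  simp only [Module.finrank_fintype_fun_eq_card, Fintype.card_fin] at h1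
  omega

theorem cochar_mul_mem_of_mem_orthLattice {X : Set (Torus K n)} (hX : IsClosed X) {a : Fin n → ℤ}
    (ha : a ∈ orthLattice (stabLattice X)) (t : Kˣ) {x : Torus K n} (hx : x ∈ X) :
    cochar a t * x ∈ X := by
  have : cochar a t ∈ stabMonoid X := by
    refine mem_of_forall_chr_eq_one (stabMonoid X) (isClosed_stab hX) fun m hm => ?_
    rw [chr_cochar, ha m hm, zpow_zero]
  exact this x hx

/-- Along a chain of `δ + 1` irreducible closed sets `tr` increases strictly, so the largest member
has `tr` at least `δ`. -/
theorem exists_irreducible_of_dim_eq {S : Set (Torus K n)} (hS : IsClosed S) {δ : ℕ}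
    (h : dim S = (δ : WithBot ℕ∞)) :
    ∃ W : Set (Torus K n), IsClosed W ∧ IsIrreducible W ∧ W ⊆ S ∧ δ ≤ tr W := by
  obtain ⟨l, hl⟩ := Order.le_krullDim_iff.1 h.ge
  let f : IrreducibleCloseds S → ℕ := fun Z => tr (closure (Subtype.val '' (Z : Set S)))
  have hirr : ∀ Z : IrreducibleCloseds S, IsIrreducible (closure (Subtype.val '' (Z : Set S))) :=
    fun Z => (Z.isIrreducible.image _ continuous_subtype_val.continuousOn).closure
  have hf : StrictMono f := fun Z Z' hZ => by
    have h1 := IrreducibleCloseds.map_strictMono_of_isInducing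
      (Topology.IsInducing.subtypeVal (t := S)) hZ
    exact tr_lt_of_ssubset isClosed_closure (hirr Z') isClosed_closure (hirr Z)
      (SetLike.coe_ssubset_coe.2 h1)
  refine ⟨closure (Subtype.val '' (l.last : Set S)), isClosed_closure, hirr _, ?_, ?_⟩
  · refine closure_minimal ?_ hS
    rintro _ ⟨z, -, rfl⟩
    exact z.2
  · have h1 := LTSeries.head_add_length_le_nat (l.map f hf)
    rw [LTSeries.last_map] at h1
    change _ + l.length ≤ _ at h1
    rw [hl] at h1
    exact le_trans (Nat.le_add_left _ _) h1

/-- With `W` in the stabilizer and `δ ≤ tr W`, the characters trivial on the stabilizer are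
relations of `W`, so their rank is at most `n - δ`; pass to the orthogonal lattice. -/
theorem le_finrank_orthLattice_stabLattice {X : Set (Torus K n)} (hX : IsClosed X) {δ : ℕ}
    (h : dim (stab X) = (δ : WithBot ℕ∞)) :
    δ ≤ Module.finrank ℤ (orthLattice (stabLattice X)) := by
  obtain ⟨W, hWc, hWi, hWS, hW⟩ := exists_irreducible_of_dim_eq (isClosed_stab hX) h
  have h1 := tr_add_finrank_le hWi
  have h2 : stabLattice X ≤ relLattice W := fun m hm => ⟨1, fun x hx => hm x (hWS hx)⟩
  have h3 := Submodule.finrank_mono h2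
  have h4 := le_finrank_orthLattice_add (stabLattice X)
  omega

/-- Multiplication by a point of `X` embeds the stabilizer in `X`. -/
theorem dim_stab_le {X : Set (Torus K n)} (hX : X.Nonempty) : dim (stab X) ≤ dim X := by
  obtain ⟨x₀, hx₀⟩ := hX
  let f : stab X → X := fun g => ⟨x₀ * g, by rw [mul_comm]; exact g.2 x₀ hx₀⟩
  have hf : Topology.IsInducing f := by
    refine Topology.IsInducing.subtypeVal.of_comp_iff.1 ?_
    exact (translate x₀).isInducing.comp Topology.IsInducing.subtypeVal
  exact hf.topologicalKrullDim_le

end Stabilizer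

end AlgTorus

/-! ### The main theorem -/

open AlgTorus

theorem theorem1p2 {K : Type*} [Field K] [IsAlgClosed K] {n : ℕ}
    (X : Set (AlgTorus.Torus K n)) (hX : AlgTorus.IsAlgebraicSet X)
    (hirr : IsIrreducible X) (hadm : AlgTorus.IsAdmissible X)
    (d δ : ℕ) (hd : AlgTorus.dim X = (d : WithBot ℕ∞))
    (hδ : AlgTorus.dim (AlgTorus.stab X) = (δ : WithBot ℕ∞)) :
    δ ≤ d ∧ ∃ C : ℝ, ∀ T : ℝ, 1 ≤ T →
      (AlgTorus.torsionUpTo X T).Finite ∧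
      ((AlgTorus.torsionUpTo X T).ncard : ℝ) ≤
        C * T ^ ((d : ℝ) + 1 - 1 / ((d : ℝ) - (δ : ℝ) + 1)) := by
  have hXc := hX.isClosed
  have hδd : δ ≤ d := by
    have := dim_stab_le hirr.1
    rw [hd, hδ] at this
    exact_mod_cast this
  have hδdR : (δ : ℝ) ≤ d := by exact_mod_cast hδd
  suffices h : TorsionBound X ((d : ℝ) + 1 - 1 / ((d : ℝ) - (δ : ℝ) + 1)) by
    obtain ⟨C, hC⟩ := h
    exact ⟨hδd, C, fun T hT => ⟨finite_torsionUpTo X T, hC T hT⟩⟩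
  rcases hadm with hfin | hadm
  -- A finite set needs only a nonnegative exponent.
  · refine ⟨X.ncard, fun T hT => ?_⟩
    have h1 : (1 : ℝ) ≤ T ^ ((d : ℝ) + 1 - 1 / ((d : ℝ) - (δ : ℝ) + 1)) := by
      refine Real.one_le_rpow hT ?_
      have : 1 / ((d : ℝ) - (δ : ℝ) + 1) ≤ 1 := by
        rw [div_le_one] <;> linarith
      have := Nat.cast_nonneg (α := ℝ) d
      linarith
    have h2 : ((torsionUpTo X T).ncard : ℝ) ≤ X.ncard := by
      exact_mod_cast Set.ncard_le_ncard (s := torsionUpTo X T) (t := X) (fun x hx => hx.1) hfin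
    exact h2.trans (le_mul_of_one_le_right (Nat.cast_nonneg _) h1)
  by_cases hnc : tr X + Module.finrank ℤ (relLattice X) < n
  · obtain ⟨hlt, hbd⟩ := torsionBound_of_stabilizer δ hXc hirr hnc (orthLattice (stabLattice X))
      (le_finrank_orthLattice_stabLattice hXc hδ)
      fun a ha t x hx => cochar_mul_mem_of_mem_orthLattice hXc ha t hx
    have htr : tr X ≤ d := by
      have := tr_le_dim hXc hirr
      rw [hd] at this
      exact_mod_cast this
    have htrR : (tr X : ℝ) ≤ d := by exact_mod_cast htr
    have hltR : (δ : ℝ) < tr X := by exact_mod_cast hlt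
    -- The exponent is increasing in the dimension, so `tr X` may be replaced by `d`.
    refine hbd.mono subset_rfl ?_
    have : 1 / ((d : ℝ) - (δ : ℝ) + 1) ≤ 1 / ((tr X : ℝ) - δ + 1) := by
      apply one_div_le_one_div_of_le <;> linarith
    linarith
  -- A torsion point on `X` would make `X` itself a forbidden torsion coset, so there is none.
  · refine ⟨0, fun T _ => ?_⟩
    have hempty : torsionUpTo X T = ∅ := by
      rw [Set.eq_empty_iff_forall_notMem]
      rintro ζ ⟨hζX, hζ, -⟩
      exact hadm X (isTorsionCoset_of_le hXc hirr (not_lt.1 hnc) hζX hζ) rfl subset_rfl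
    simp [hempty]
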